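/- **Setting.** Let $N\ge 1$, $\Sigma=\{1,\dots,N\}$, and let $X=\bigcup_{n\ge 0}\Sigma^n$ be the $N$-ary tree of finite words, with root $o$ the empty word and edge set $\mathcal E_v$ joining each nonempty word $x$ to its predecessor $x^-$. An *$N$-ary augmented tree* is a graph $(X,\mathcal E)$ with $\mathcal E=\mathcal E_v\cup\mathcal E_h$, where $\mathcal E_h\subset (X\times X)\setminus\{(x,x)\}$ is symmetric and $(x,y)\in\mathcal E_h$ implies $|x|=|y|$ and either $x^-=y^-$ or $(x^-,y^-)\in\mathcal E_h$. A *horizontal component* is a connected component of a level $\Sigma^n$ with respect to $\mathcal E_h$. For a horizontal component $T$ let $T_{\mathcal D}$ be the set of words with an initial segment in $T$; $(T_{\mathcal D},\mathcal E)$ is the induced subgraph. Write $T\sim T'$ if there is a bijection $T_{\mathcal D}\to T'_{\mathcal D}$ which, with its inverse, preserves vertical and horizontal edges; $[T]$ is the class of $T$. The augmented tree is *simple* if there are finitely many classes. Let $[T_1],\dots,[T_m]$ be the classes of the horizontal components contained in $T_{\mathcal D}$ other than $T$ itself; the *incidence matrix* of $T_{\mathcal D}$ is $A=[a_{ij}]$,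 where $a_{ij}$ is the number of horizontal components, formed by the offspring of a component in $[T_i]$, that belong to $[T_j]$. $A$ is *primitive* if some power $A^n$, $n\ge 1$, has only positive entries. For a connected graph with graph distance $d$ and root $o$ put $|x\wedge y|=\frac12(d(o,x)+d(o,y)-d(x,y))$. The graph is *hyperbolic* if for some $\delta\ge0$, $|x\wedge y|\ge\min\{|x\wedge z|,|z\wedge y|\}-\delta$ for all $x,y,z$. For $a>0$ put $\rho_a(x,y)=e^{-a|x\wedge y|}$ for $x\ne y$ and $\rho_a(x,x)=0$. The *hyperbolic boundary* $\partial$ is the set of points added by completing the vertex set with respect to $\rho_a$, i.e. $\rho_a$-Cauchy sequences without limit in the vertex set, with $(x_n),(y_n)$ identified when $\rho_a(x_n,y_n)\to0$; it carries the extension $\rho_a(\xi,\eta)=\inf\limsup_{i,j\to\infty}\rho_a(x_i,y_j)$, the infimum over all sequences $(x_i)$ representing $\xi$ and $(y_j)$ representing $\eta$. *Lipschitz equivalent* ($\simeq$) means that there are a bijection $f$ and $C>0$ with $C^{-1}\rho(\xi,\eta)\le\rho'(f(\xi),f(\eta))\le C\rho(\xi,\eta)$ for all $\xi,\eta$. A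 *near-isometry* between two graphs is a bijection $\sigma$ between the complements of two finite sets of vertices such that, for some $c>0$, $|d(\sigma(x),\sigma(y))-d(x,y)|<c$ for all $x,y$ in its domain. **Proposition 4.2.** Let $(X,\mathcal E)$ be a simple $N$-ary augmented tree, let $T$ be a horizontal component, and suppose that the incidence matrix of $T_{\mathcal D}$ is primitive. Then $(T_{\mathcal D},\mathcal E)$ is hyperbolic and $\partial(T_{\mathcal D},\mathcal E)\simeq\partial(X,\mathcal E_v)$, for every choice of the root of $T_{\mathcal D}$ and, with the same $a$ on both sides, for every $a>0$ (the root of $X$ being the empty word). Moreover, there is a near-isometry from $(T_{\mathcal D},\mathcal E)$ to the union of $\ell=\#T$ copies of $(X,\mathcal E_v)$, i.e. the disjoint copies together with one additional vertex joined to the root of each copy. -/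

import Mathlib

open Filter Topology

noncomputable section

/-! ### Rooted graphs, Gromov products and hyperbolic boundaries -/

section Hyperbolic

variable {V : Type*}

/-- The Gromov product `|x ∧ y| = (|x| + |y| - d(x, y)) / 2` of a connected graph with root `o`,
where `d` is the graph distance and `|x| = d(o, x)`. -/
def gromovProduct (G : SimpleGraph V) (o x y : V) : ℝ :=
  ((G.dist o x : ℝ) + (G.dist o y : ℝ) - (G.dist x y : ℝ)) / 2

/-- Hyperbolicity of a connected graph with respect to the root `o`. -/
def IsHyperbolicGraph (G : SimpleGraph V) (o : V) : Prop :=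
  ∃ δ : ℝ, 0 ≤ δ ∧ ∀ x y z : V,
    min (gromovProduct G o x z) (gromovProduct G o z y) - δ ≤ gromovProduct G o x y

open scoped Classical in
/-- The hyperbolic (quasi-)metric `ρ_a(x, y) = exp (-a |x ∧ y|)` for `x ≠ y`, `ρ_a(x, x) = 0`. -/
def hypRho (G : SimpleGraph V) (o : V) (a : ℝ) (x y : V) : ℝ :=
  if x = y then 0 else Real.exp (-a * gromovProduct G o x y)

/-- The `ρ_a`-Cauchy sequences of vertices that do not converge to a vertex. -/
def BoundarySeq (G : SimpleGraph V) (o : V) (a : ℝ) : Type _ :=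
  {x : ℕ → V //
    Tendsto (fun p : ℕ × ℕ => hypRho G o a (x p.1) (x p.2)) atTop (𝓝 0) ∧
    ∀ v : V, ¬ Tendsto (fun n => hypRho G o a (x n) v) atTop (𝓝 0)}

/-- The hyperbolic boundary: the points that completion with respect to `ρ_a` adds to the vertex
set, i.e. the Cauchy sequences without a limit in the vertex set, where `(x_n)` and `(y_n)` are
identified if `ρ_a(x_n, y_n) → 0` (in a hyperbolic graph this is an equivalence relation). -/
def HypBoundary (G : SimpleGraph V) (o : V) (a : ℝ) : Type _ :=
  Quot fun x y : BoundarySeq G o a =>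
    Tendsto (fun n => hypRho G o a (x.1 n) (y.1 n)) atTop (𝓝 0)

/-- The extension of `ρ_a` to the boundary, `ρ_a(ξ, η) = inf limsup_{i,j} ρ_a(x_i, y_j)` over all
sequences `x → ξ`, `y → η`; for `ξ ≠ η` this is `exp (-a |ξ ∧ η|)` with Gromov's extended product
`|ξ ∧ η| = sup liminf_{i,j} |x_i ∧ y_j|`. -/
def boundaryRho (G : SimpleGraph V) (o : V) (a : ℝ) (ξ η : HypBoundary G o a) : ℝ :=
  sInf {r : ℝ | ∃ x y : BoundarySeq G o a, Quot.mk _ x = ξ ∧ Quot.mk _ y = η ∧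
    r = limsup (fun p : ℕ × ℕ => hypRho G o a (x.1 p.1) (y.1 p.2)) atTop}

end Hyperbolic

/-- Lipschitz equivalence of two sets with given distance functions: there is a bijection `f` with
`C⁻¹ d(x, y) ≤ d'(f x, f y) ≤ C d(x, y)`. -/
def LipschitzEquivalent {α β : Type*} (dα : α → α → ℝ) (dβ : β → β → ℝ) : Prop :=
  ∃ f : α ≃ β, ∃ C : ℝ, 0 < C ∧ ∀ x y : α,
    C⁻¹ * dα x y ≤ dβ (f x) (f y) ∧ dβ (f x) (f y) ≤ C * dα x y

/-- There is a near-isometry from `G` to `H`: a bijection between the complements of two finite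
sets of vertices that changes distances by less than a constant. -/
def NearIsometric {V W : Type*} (G : SimpleGraph V) (H : SimpleGraph W) : Prop :=
  ∃ (E : Set V) (F : Set W) (c : ℝ) (σ : (Eᶜ : Set V) ≃ (Fᶜ : Set W)),
    E.Finite ∧ F.Finite ∧ 0 < c ∧
    ∀ x y : (Eᶜ : Set V), |(H.dist (σ x : W) (σ y : W) : ℝ) - (G.dist (x : V) (y : V) : ℝ)| < c

/-- The union of `ℓ` copies of the graph `G` with root `o`: the disjoint copies together with one
additional vertex `none`, which is joined to the root of each copy. -/
def copiesUnion {V : Type*} (G : SimpleGraph V) (o : V) (ℓ : ℕ) :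
    SimpleGraph (Option (Fin ℓ × V)) where
  Adj p q := match p, q with
    | none, none => False
    | none, some q => q.2 = o
    | some p, none => p.2 = o
    | some p, some q => p.1 = q.1 ∧ G.Adj p.2 q.2
  symm := ⟨by
    rintro (_ | p) (_ | q) h
    · exact h
    · exact h
    · exact h
    · exact ⟨h.1.symm, h.2.symm⟩⟩
  loopless := ⟨by
    rintro (_ | p) h
    · exact h
    · exact G.loopless.irrefl _ h.2⟩

/-! ### Augmented trees -/

/-- The `N`-ary tree `(X, ℰ_v)` on the finite words over an alphabet with `N` letters: the
predecessor of a nonempty word is obtained by deleting its last letter, and the root is the empty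
word. -/
def naryTree (N : ℕ) : SimpleGraph (List (Fin N)) where
  Adj x y := (x ≠ [] ∧ x.dropLast = y) ∨ (y ≠ [] ∧ y.dropLast = x)
  symm := ⟨fun _ _ h => h.symm⟩
  loopless := ⟨by
    have key : ∀ x : List (Fin N), ¬ (x ≠ [] ∧ x.dropLast = x) := by
      rintro x ⟨h, h'⟩
      have h1 := congrArg List.length h'
      have h2 := List.length_pos_iff.2 h
      rw [List.length_dropLast] at h1
      omega
    intro x h
    exact h.elim (key x) (key x)⟩

/-- An `N`-ary augmented tree: a set of horizontal edges on the `N`-ary tree, each of which joins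
two distinct words of equal length whose predecessors are equal or joined by a horizontal edge. -/
structure AugmentedTree (N : ℕ) where
  horizontal : SimpleGraph (List (Fin N))
  length_eq : ∀ x y, horizontal.Adj x y → x.length = y.length
  pred : ∀ x y, horizontal.Adj x y →
    x.dropLast = y.dropLast ∨ horizontal.Adj x.dropLast y.dropLast

namespace AugmentedTree

variable {N : ℕ} (X : AugmentedTree N)

/-- The augmented tree `(X, ℰ)`, `ℰ = ℰ_v ∪ ℰ_h`, as a graph. -/
def graph : SimpleGraph (List (Fin N)) := naryTree N ⊔ X.horizontal

/-- The horizontal components: since horizontal edges join words of equal length, these are the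
connected components with respect to the horizontal edges. -/
abbrev Component : Type := X.horizontal.ConnectedComponent

variable {X}

/-- `T_𝒟`: the words that have an initial segment in `T` (the elements of `T` included). -/
def descendants (T : X.Component) : Set (List (Fin N)) :=
  {x | ∃ y ∈ T.supp, y <+: x}

/-- `(T_𝒟, ℰ)` as a subgraph of `(X, ℰ)`. -/
def descendantGraph (T : X.Component) : SimpleGraph (descendants T) :=
  X.graph.induce (descendants T)

/-- `T ∼ T'`: there is a bijection from `T_𝒟` onto `T'_𝒟` which, together with its inverse,
preserves the vertical and the horizontal edges. -/
def ComponentEquiv (T T' : X.Component) : Prop :=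
  ∃ g : descendants T ≃ descendants T', ∀ x y : descendants T,
    ((naryTree N).Adj (x : List (Fin N)) y ↔ (naryTree N).Adj (g x : List (Fin N)) (g y)) ∧
    (X.horizontal.Adj (x : List (Fin N)) y ↔ X.horizontal.Adj (g x : List (Fin N)) (g y))

variable (X)

instance componentSetoid : Setoid X.Component where
  r := ComponentEquiv
  iseqv :=
    { refl := fun _ => ⟨Equiv.refl _, fun _ _ => ⟨Iff.rfl, Iff.rfl⟩⟩
      symm := by
        rintro T T' ⟨g, hg⟩
        refine ⟨g.symm, fun x y => ?_⟩
        have h := hg (g.symm x) (g.symm y)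
        simp only [Equiv.apply_symm_apply] at h
        exact ⟨h.1.symm, h.2.symm⟩
      trans := by
        rintro T T' T'' ⟨g, hg⟩ ⟨g', hg'⟩
        exact ⟨g.trans g', fun x y =>
          ⟨(hg x y).1.trans (hg' _ _).1, (hg x y).2.trans (hg' _ _).2⟩⟩ }

/-- The equivalence classes `[T]` of horizontal components. -/
abbrev ComponentClass : Type := Quotient (componentSetoid X)

/-- `(X, ℰ)` is simple if there are only finitely many equivalence classes. -/
class IsSimple : Prop where
  finite : Finite X.ComponentClass

variable {X}

/-- The horizontal components formed by the offspring of the vertices of `T`. -/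
def offspring (T : X.Component) : Set X.Component :=
  {S | ∃ x ∈ T.supp, ∃ i : Fin N, S = X.horizontal.connectedComponentMk (x ++ [i])}

/-- The equivalence classes of the horizontal components of `T_𝒟` below its initial one `T`. They
index the incidence matrix of `T_𝒟`. -/
def DescendantClass (T : X.Component) : Type :=
  {c : X.ComponentClass // ∃ S : X.Component, S ≠ T ∧ S.supp ⊆ descendants T ∧
    (Quotient.mk _ S : X.ComponentClass) = c}

instance (T : X.Component) [h : X.IsSimple] : Finite (DescendantClass T) :=
  haveI := h.finite
  Subtype.finite

instance (T : X.Component) [X.IsSimple] : Fintype (DescendantClass T) := Fintype.ofFinite _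

instance (T : X.Component) : DecidableEq (DescendantClass T) := Classical.decEq _

/-- The incidence matrix of `T_𝒟`: the entry at `(c, c')` is the number of the horizontal
components formed by the offspring of `S` that belong to the class `c'`, for `S` in the class `c`
(it does not depend on the choice of `S`). -/
def incidenceMatrix (T : X.Component) : Matrix (DescendantClass T) (DescendantClass T) ℤ :=
  fun c c' =>
    ({S' ∈ offspring c.1.out | (Quotient.mk _ S' : X.ComponentClass) = c'.1}.ncard : ℤ)

end AugmentedTree

end

/-! The proof has a geometric half and a combinatorial half.

Geometry. A horizontal edge projects to a horizontal edge or collapses, so the horizontal components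
themselves form a tree. Equivalent components have equally many words, so simplicity bounds the size
of all components by some `M`. Going up from `x` to the last level `meet` at which the ancestors of
`x` and `y` share a component, across that component, and down to `y` shows that `d(x, y)` is `|x| +
|y| - 2 meet x y` up to `M` (`hasMeet_descendantGraph`). Gromov products therefore agree with `meet`
up to a constant, and `meet` is exactly ultrametric, whence hyperbolicity. The tree of words and its
unions of copies satisfy the same formula with common prefixes and no error. Distances and boundary
metrics are thus controlled by these products, and it suffices to find a bijection off finite sets
that changes the products boundedly.

Combinatorics. Dividing the sizes of the components strictly below `T` by their gcd gives weights,
and the components `k` levels below `S` have total weight `N ^ k` times the weight of `S`. By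
primitivity, at a suitable depth every class occurs so often that Bézout corrections split these
components into equal groups, one of weight `N ^ k` for each unit of weight of `S`
(`exists_even_assignment`). Matching the words of length `k` with the units in a group yields a
machine that reads words in blocks (`IsStep`, `run`). A component reached by it determines the whole
word read except the last block (`run_fst_inj`), so common prefixes and common components have equal
depth up to a constant. Since units and vertices of a component differ boundedly in number, there
are compatible injections between vertices and words in both directions, and a Schröder–Bernstein
argument respecting the correspondence makes a bijection with finitely many copies of the tree of
words (`exists_roughEquiv_copies`). For `N ≥ 2` any positive number of copies is roughly equivalent
to one (`roughEquiv_copies`); for `N = 1` all the numbers of copies involved are 1. -/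

section Boundary

/-! ### Gromov products and maps between hyperbolic boundaries -/

variable {V W : Type*} {G : SimpleGraph V} {H : SimpleGraph W}

theorem gromovProduct_comm (o x y : V) : gromovProduct G o x y = gromovProduct G o y x := by
  simp only [gromovProduct, G.dist_comm (u := x) (v := y)]; ring

theorem gromovProduct_nonneg (hG : G.Connected) (o x y : V) : 0 ≤ gromovProduct G o x y := by
  have h : G.dist x y ≤ G.dist x o + G.dist o y := hG.dist_triangle
  rw [G.dist_comm (u := x) (v := o)] at h
  have h' : (G.dist x y : ℝ) ≤ G.dist o x + G.dist o y := by exact_mod_cast h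
  unfold gromovProduct
  linarith

theorem gromovProduct_le_right (hG : G.Connected) (o x y : V) :
    gromovProduct G o x y ≤ G.dist o y := by
  have h : G.dist o x ≤ G.dist o y + G.dist y x := hG.dist_triangle
  rw [G.dist_comm (u := y) (v := x)] at h
  have h' : (G.dist o x : ℝ) ≤ G.dist o y + G.dist x y := by exact_mod_cast h
  unfold gromovProduct
  linarith

theorem hypRho_nonneg (o : V) (a : ℝ) (x y : V) : 0 ≤ hypRho G o a x y := by
  unfold hypRho; split_ifs <;> positivity

theorem hypRho_comm (o : V) (a : ℝ) (x y : V) : hypRho G o a x y = hypRho G o a y x := by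
  by_cases h : x = y
  · rw [h]
  · simp only [hypRho, gromovProduct_comm o x y, if_neg h, if_neg (Ne.symm h)]

theorem hypRho_le_one (hG : G.Connected) (o : V) {a : ℝ} (ha : 0 < a) (x y : V) :
    hypRho G o a x y ≤ 1 := by
  unfold hypRho
  split_ifs
  · exact zero_le_one
  · rw [Real.exp_le_one_iff]
    nlinarith [gromovProduct_nonneg hG o x y]

theorem hypRho_le_mul {o : V} {o' : W} {a c : ℝ} (ha : 0 < a) {x y : V} {x' y' : W}
    (hxy : x = y → x' = y') (h : gromovProduct G o x y - c ≤ gromovProduct H o' x' y') :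
    hypRho H o' a x' y' ≤ Real.exp (a * c) * hypRho G o a x y := by
  unfold hypRho
  by_cases h1 : x' = y'
  · rw [if_pos h1]; split_ifs <;> positivity
  · rw [if_neg h1, if_neg (fun h => h1 (hxy h)), ← Real.exp_add, Real.exp_le_exp]
    nlinarith

/-- Vertices are isolated: `|x ∧ v| ≤ d(o, v)` keeps `ρ_a(x, v)` above `exp (-a d(o, v))` for every
`x ≠ v`. -/
theorem eventually_eq_of_hypRho (hG : G.Connected) {o : V} {a : ℝ} (ha : 0 < a) {x : ℕ → V} {v : V}
    (h : Tendsto (fun n => hypRho G o a (x n) v) atTop (𝓝 0)) : ∀ᶠ n in atTop, x n = v := by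
  have h1 : ∀ᶠ n in atTop, hypRho G o a (x n) v < Real.exp (-a * G.dist o v) :=
    h.eventually (gt_mem_nhds (Real.exp_pos _))
  filter_upwards [h1] with n hn
  by_contra hne
  rw [hypRho, if_neg hne, Real.exp_lt_exp] at hn
  nlinarith [gromovProduct_le_right hG o (x n) v]

/-- A Cauchy sequence that returns to `v` infinitely often converges to `v`. Boundary sequences
therefore leave every finite set, which is why finite exceptional sets do not affect the boundary.
-/
theorem BoundarySeq.eventually_ne {o : V} {a : ℝ} (x : BoundarySeq G o a) (v : V) :
    ∀ᶠ n in atTop, x.1 n ≠ v := by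
  by_contra hcon
  have hf : ∃ᶠ n in atTop, x.1 n = v := by simpa [Filter.Frequently] using hcon
  refine x.2.2 v ?_
  rw [Metric.tendsto_atTop]
  intro ε hε
  have h1 := x.2.1
  rw [Metric.tendsto_atTop] at h1
  obtain ⟨⟨p, q⟩, hpq⟩ := h1 ε hε
  obtain ⟨n, hnv, hn⟩ := (hf.and_eventually (eventually_ge_atTop p)).exists
  refine ⟨q, fun m hm => ?_⟩
  have h2 := hpq (n, m) ⟨hn, hm⟩
  simp only [hnv] at h2
  rwa [hypRho_comm]

theorem BoundarySeq.eventually_notMem {o : V} {a : ℝ} (x : BoundarySeq G o a) {E : Set V}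
    (hE : E.Finite) : ∀ᶠ n in atTop, x.1 n ∉ E := by
  have h : ∀ᶠ n in atTop, ∀ v ∈ E, x.1 n ≠ v :=
    (hE.eventually_all (l := atTop) (p := fun v n => x.1 n ≠ v)).2
      fun v _ => x.eventually_ne v
  filter_upwards [h] with n hn hmem
  exact hn _ hmem rfl

theorem eventually_prod_atTop {P Q : ℕ → Prop} (hP : ∀ᶠ n in atTop, P n)
    (hQ : ∀ᶠ n in atTop, Q n) : ∀ᶠ p : ℕ × ℕ in atTop, P p.1 ∧ Q p.2 := by
  rw [← prod_atTop_atTop_eq]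
  exact hP.prod_mk hQ

theorem isBoundedUnder_hypRho (hG : G.Connected) {o : V} {a : ℝ} (ha : 0 < a) (x y : ℕ → V) :
    IsBoundedUnder (· ≤ ·) atTop (fun p : ℕ × ℕ => hypRho G o a (x p.1) (y p.2)) :=
  isBoundedUnder_of ⟨1, fun _ => hypRho_le_one hG o ha _ _⟩

theorem isCoboundedUnder_hypRho {o : V} {a : ℝ} (x y : ℕ → V) :
    IsCoboundedUnder (· ≤ ·) atTop (fun p : ℕ × ℕ => hypRho G o a (x p.1) (y p.2)) := by
  have h : IsBoundedUnder (· ≥ ·) atTop (fun p : ℕ × ℕ => hypRho G o a (x p.1) (y p.2)) :=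
    isBoundedUnder_of ⟨0, fun p => hypRho_nonneg _ _ _ _⟩
  exact h.isCoboundedUnder_le

/-- `φ` is injective off the finite set `E` and changes Gromov products there by at most `c`. -/
structure RoughMap (G : SimpleGraph V) (H : SimpleGraph W) (o : V) (o' : W) (E : Set V) (c : ℝ)
    (φ : V → W) : Prop where
  finite : E.Finite
  injOn : Set.InjOn φ Eᶜ
  gromov : ∀ x ∉ E, ∀ y ∉ E, |gromovProduct H o' (φ x) (φ y) - gromovProduct G o x y| ≤ c

namespace RoughMap

variable {o : V} {o' : W} {E : Set V} {c : ℝ} {φ : V → W}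

theorem hypRho_le (h : RoughMap G H o o' E c φ) {a : ℝ} (ha : 0 < a) {x y : V} (hx : x ∉ E)
    (hy : y ∉ E) : hypRho H o' a (φ x) (φ y) ≤ Real.exp (a * c) * hypRho G o a x y :=
  hypRho_le_mul ha (congrArg φ) (by have := (abs_le.1 (h.gromov x hx y hy)).1; linarith)

/-- The image of a boundary sequence under a rough map. -/
def mapSeq (h : RoughMap G H o o' E c φ) (hH : H.Connected) {a : ℝ} (ha : 0 < a)
    (x : BoundarySeq G o a) : BoundarySeq H o' a :=
  ⟨fun n => φ (x.1 n), by
    refine ⟨?_, fun v hv => ?_⟩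
    · have h1 : Tendsto (fun p : ℕ × ℕ => Real.exp (a * c) * hypRho G o a (x.1 p.1) (x.1 p.2)) atTop
          (𝓝 0) := by simpa using x.2.1.const_mul (Real.exp (a * c))
      refine squeeze_zero' (Eventually.of_forall fun p => hypRho_nonneg _ _ _ _) ?_ h1
      have h2 := x.eventually_notMem h.finite
      filter_upwards [eventually_prod_atTop h2 h2] with p hp
      exact h.hypRho_le ha hp.1 hp.2
    -- If the images converged to a vertex they would be eventually constant; by injectivity so
    -- would `x`, which contradicts that `x` leaves every vertex.
    · have h1 := (eventually_eq_of_hypRho hH ha hv).and (x.eventually_notMem h.finite)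
      obtain ⟨n, hn⟩ := eventually_atTop.1 h1
      have h2 := x.eventually_ne (x.1 n)
      obtain ⟨m, hm, hmn⟩ := (h2.and (eventually_ge_atTop n)).exists
      exact hm (h.injOn (hn m hmn).2 (hn n le_rfl).2 ((hn m hmn).1.trans (hn n le_rfl).1.symm))⟩

/-- The map between hyperbolic boundaries induced by a rough map. -/
def mapBoundary (h : RoughMap G H o o' E c φ) (hH : H.Connected) {a : ℝ} (ha : 0 < a) :
    HypBoundary G o a → HypBoundary H o' a :=
  Quot.map (h.mapSeq hH ha) fun x y hxy => by
    have h1 : Tendsto (fun n => Real.exp (a * c) * hypRho G o a (x.1 n) (y.1 n)) atTop (𝓝 0) := by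
      simpa using hxy.const_mul (Real.exp (a * c))
    refine squeeze_zero' (Eventually.of_forall fun p => hypRho_nonneg _ _ _ _) ?_ h1
    filter_upwards [x.eventually_notMem h.finite, y.eventually_notMem h.finite] with n hx hy
    exact h.hypRho_le ha hx hy

theorem boundaryRho_le (h : RoughMap G H o o' E c φ) (hG : G.Connected) (hH : H.Connected) {a : ℝ}
    (ha : 0 < a) (ξ η : HypBoundary G o a) :
    boundaryRho H o' a (h.mapBoundary hH ha ξ) (h.mapBoundary hH ha η) ≤
      Real.exp (a * c) * boundaryRho G o a ξ η := by
  have hpos := Real.exp_pos (a * c)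
  rw [← div_le_iff₀' hpos]
  unfold boundaryRho
  refine le_csInf ?_ ?_
  · obtain ⟨x, rfl⟩ := Quot.exists_rep ξ
    obtain ⟨y, rfl⟩ := Quot.exists_rep η
    exact ⟨_, x, y, rfl, rfl, rfl⟩
  · rintro r ⟨x, y, rfl, rfl, rfl⟩
    rw [div_le_iff₀' hpos]
    -- The image sequences are among the representatives over which the infimum on the left is
    -- taken.
    refine le_trans (csInf_le ?_ ?_)
      (?_ : limsup (fun p : ℕ × ℕ => hypRho H o' a (φ (x.1 p.1)) (φ (y.1 p.2))) atTop ≤ _)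
    · refine ⟨0, ?_⟩
      rintro r ⟨x, y, -, -, rfl⟩
      refine le_limsup_of_le (isBoundedUnder_hypRho hH ha x.1 y.1) fun b hb =>
        (hb.exists).elim fun p hp => (hypRho_nonneg _ _ _ _).trans hp
    · exact ⟨h.mapSeq hH ha x, h.mapSeq hH ha y, rfl, rfl, rfl⟩
    · have hev : ∀ᶠ p : ℕ × ℕ in atTop, hypRho H o' a (φ (x.1 p.1)) (φ (y.1 p.2)) ≤
          Real.exp (a * c) * hypRho G o a (x.1 p.1) (y.1 p.2) := by
        filter_upwards [eventually_prod_atTop (x.eventually_notMem h.finite)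
          (y.eventually_notMem h.finite)] with p hp
        exact h.hypRho_le ha hp.1 hp.2
      refine le_of_forall_pos_le_add fun ε hε => ?_
      refine limsup_le_of_le (isCoboundedUnder_hypRho (h.mapSeq hH ha x).1 (h.mapSeq hH ha y).1) ?_
      have hlt : limsup (fun p : ℕ × ℕ => hypRho G o a (x.1 p.1) (y.1 p.2)) atTop <
          limsup (fun p : ℕ × ℕ => hypRho G o a (x.1 p.1) (y.1 p.2)) atTop +
            ε / Real.exp (a * c) := by
        have := div_pos hε hpos; linarith
      filter_upwards [hev, eventually_lt_of_limsup_lt hlt (isBoundedUnder_hypRho hG ha x.1 y.1)] with p h1 h2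
      refine h1.trans ?_
      have h3 := mul_le_mul_of_nonneg_left h2.le hpos.le
      rwa [mul_add, mul_div_cancel₀ _ hpos.ne'] at h3

theorem mapBoundary_leftInverse (h : RoughMap G H o o' E c φ) {F : Set W} {ψ : W → V}
    (h' : RoughMap H G o' o F c ψ) (hG : G.Connected) (hH : H.Connected) {a : ℝ} (ha : 0 < a)
    (hinv : ∀ x ∉ E, ψ (φ x) = x) :
    Function.LeftInverse (h'.mapBoundary hG ha) (h.mapBoundary hH ha) := by
  intro ξ
  obtain ⟨x, rfl⟩ := Quot.exists_rep ξ
  refine Quot.sound ?_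
  refine tendsto_const_nhds.congr' ?_
  filter_upwards [x.eventually_notMem h.finite] with n hn
  simp [mapSeq, hypRho, hinv _ hn]

end RoughMap

/-- A bijection off finite sets which changes Gromov products by a bounded amount induces a
Lipschitz equivalence of the hyperbolic boundaries. -/
theorem lipschitzEquivalent_boundaryRho (hG : G.Connected) (hH : H.Connected) (o : V) (o' : W)
    {E : Set V} {F : Set W} (hE : E.Finite) (hF : F.Finite) (σ : (Eᶜ : Set V) ≃ (Fᶜ : Set W))
    (c : ℝ)
    (hσ : ∀ x y, |gromovProduct H o' (σ x) (σ y) - gromovProduct G o (x : V) (y : V)| ≤ c)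
    {a : ℝ} (ha : 0 < a) : LipschitzEquivalent (boundaryRho G o a) (boundaryRho H o' a) := by
  classical
  -- The values `o'` and `o` on the finite exceptional sets are arbitrary.
  let φ : V → W := fun x => if h : x ∈ Eᶜ then σ ⟨x, h⟩ else o'
  let ψ : W → V := fun y => if h : y ∈ Fᶜ then σ.symm ⟨y, h⟩ else o
  have hφ : ∀ x (h : x ∈ Eᶜ), φ x = σ ⟨x, h⟩ := fun x h => dif_pos h
  have hψ : ∀ x (h : x ∈ Fᶜ), ψ x = σ.symm ⟨x, h⟩ := fun x h => dif_pos h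
  have hψφ : ∀ x ∉ E, ψ (φ x) = x := fun x h => by
    rw [hφ x h, hψ _ (σ ⟨x, h⟩).2]; simp
  have hφψ : ∀ x ∉ F, φ (ψ x) = x := fun x h => by
    rw [hψ x h, hφ _ (σ.symm ⟨x, h⟩).2]; simp
  have h1 : RoughMap G H o o' E c φ := by
    refine ⟨hE, fun x hx y hy hxy => ?_, fun x hx y hy => ?_⟩
    · rw [← hψφ x hx, hxy, hψφ y hy]
    · rw [hφ x hx, hφ y hy]; exact hσ _ _
  have h2 : RoughMap H G o' o F c ψ := by
    refine ⟨hF, fun x hx y hy hxy => ?_, fun x hx y hy => ?_⟩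
    · rw [← hφψ x hx, hxy, hφψ y hy]
    · rw [hψ x hx, hψ y hy, abs_sub_comm]
      simpa using hσ (σ.symm ⟨x, hx⟩) (σ.symm ⟨y, hy⟩)
  have l := h1.mapBoundary_leftInverse h2 hG hH ha hψφ
  have r := h2.mapBoundary_leftInverse h1 hH hG ha hφψ
  refine ⟨⟨h1.mapBoundary hH ha, h2.mapBoundary hG ha, l, r⟩, Real.exp (a * c), Real.exp_pos _,
    fun ξ η => ⟨?_, h1.boundaryRho_le hG hH ha ξ η⟩⟩
  rw [inv_mul_le_iff₀ (Real.exp_pos _)]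
  have h3 := h2.boundaryRho_le hH hG ha (h1.mapBoundary hH ha ξ) (h1.mapBoundary hH ha η)
  rwa [l ξ, l η] at h3

/-- A function that grows by at most one along edges is bounded by the distance. -/
theorem sub_le_dist_of_adj {f : V → ℤ} (hf : ∀ y z, G.Adj y z → f z ≤ f y + 1) {x y : V}
    (h : G.Reachable x y) : f y - f x ≤ G.dist x y := by
  obtain ⟨p, hp⟩ := h.exists_walk_length_eq_dist
  rw [← hp]
  clear hp h
  induction p with
  | nil => simp
  | cons hadj p ih =>
    have := hf _ _ hadj
    rw [SimpleGraph.Walk.length_cons]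
    push_cast
    linarith

end Boundary

/-! ### Common prefixes and rough equivalence -/

section Words

variable {α : Type*} [DecidableEq α]

/-- The length of the longest common initial segment of two words. -/
def lcp : List α → List α → ℕ
  | a :: x, b :: y => if a = b then lcp x y + 1 else 0
  | _, _ => 0

@[simp] theorem lcp_nil_left (x : List α) : lcp [] x = 0 := by simp [lcp]

@[simp] theorem lcp_nil_right (x : List α) : lcp x [] = 0 := by cases x <;> simp [lcp]

theorem lcp_cons (a b : α) (x y : List α) :
    lcp (a :: x) (b :: y) = if a = b then lcp x y + 1 else 0 := by rw [lcp]

theorem le_lcp_iff {n : ℕ} {x y : List α} :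
    n ≤ lcp x y ↔ n ≤ x.length ∧ n ≤ y.length ∧ x.take n = y.take n := by
  induction x generalizing y n with
  | nil =>
    constructor
    · intro h; simp at h; simp [h]
    · rintro ⟨h, -⟩; simpa using h
  | cons a x ih =>
    cases y with
    | nil =>
      constructor
      · intro h; simp at h; simp [h]
      · rintro ⟨-, h, -⟩; simpa using h
    | cons b y =>
      rw [lcp_cons]
      cases n with
      | zero => simp
      | succ n =>
        split_ifs with h
        · simp [h, ih]
        · simp [h]

theorem lcp_self (x : List α) : lcp x x = x.length := by
  apply le_antisymm
  · exact (le_lcp_iff.1 le_rfl).1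
  · rw [le_lcp_iff]; simp

theorem lcp_le_left (x y : List α) : lcp x y ≤ x.length := (le_lcp_iff.1 le_rfl).1

theorem lcp_le_append (x y : List α) (a : α) : lcp x y ≤ lcp x (y ++ [a]) := by
  obtain ⟨h1, h2, h3⟩ := le_lcp_iff.1 (le_refl (lcp x y))
  refine le_lcp_iff.2 ⟨h1, by simp; omega, ?_⟩
  rw [h3, List.take_append_of_le_length h2]

theorem lcp_append_le (x y : List α) (a : α) : lcp x (y ++ [a]) ≤ lcp x y + 1 := by
  obtain ⟨h1, h2, h3⟩ := le_lcp_iff.1 (le_refl (lcp x (y ++ [a])))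
  rw [← tsub_le_iff_right]
  rw [List.length_append, List.length_singleton] at h2
  refine le_lcp_iff.2 ⟨by omega, by omega, ?_⟩
  have h4 := congrArg (List.take (lcp x (y ++ [a]) - 1)) h3
  rw [List.take_take, List.take_take, min_eq_left (by omega),
    List.take_append_of_le_length (by omega)] at h4
  exact h4

/-- The meet in a disjoint union of trees of words, all of them attached to an additional root. -/
def copyMeet {ι : Type*} [DecidableEq ι] (p q : ι × List α) : ℕ :=
  if p.1 = q.1 then lcp p.2 q.2 + 1 else 0

end Words

/-- There is a bijection which changes the given products by a bounded amount. -/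
def RoughEquiv {A B : Type*} (mA : A → A → ℕ) (mB : B → B → ℕ) : Prop :=
  ∃ (e : A ≃ B) (c : ℕ), ∀ x y, |(mB (e x) (e y) : ℤ) - mA x y| ≤ c

namespace RoughEquiv

variable {A B C : Type*} {mA : A → A → ℕ} {mB : B → B → ℕ} {mC : C → C → ℕ}

theorem symm (h : RoughEquiv mA mB) : RoughEquiv mB mA := by
  obtain ⟨e, c, he⟩ := h
  refine ⟨e.symm, c, fun x y => ?_⟩
  rw [abs_sub_comm]
  simpa using he (e.symm x) (e.symm y)

theorem trans (h : RoughEquiv mA mB) (h' : RoughEquiv mB mC) : RoughEquiv mA mC := by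
  obtain ⟨e, c, he⟩ := h
  obtain ⟨e', c', he'⟩ := h'
  refine ⟨e.trans e', c + c', fun x y => ?_⟩
  have h1 := abs_le.1 (he x y)
  have h2 := abs_le.1 (he' (e x) (e y))
  rw [abs_le]
  push_cast
  simp only [Equiv.trans_apply]
  constructor <;> linarith [h1.1, h1.2, h2.1, h2.2]

end RoughEquiv

/-! ### Absorbing copies of the tree of words -/

section Copies

variable {N : ℕ}

/-- The embedding of the tree of words over `k + 2` letters onto the words that do not begin with
the last letter. It moves `0 ⋯ 0 1 w` to `0 ⋯ 0 0 (k + 1) w`. -/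
def shiftWord {k : ℕ} : List (Fin (k + 2)) → List (Fin (k + 2))
  | [] => []
  | a :: x =>
    if a = 0 then 0 :: shiftWord x
    else if a = 1 then 0 :: Fin.last (k + 1) :: x
    else ⟨a.1 - 1, by omega⟩ :: x

variable {k : ℕ}

theorem shiftWord_zero (x : List (Fin (k + 2))) : shiftWord (0 :: x) = 0 :: shiftWord x := by
  simp [shiftWord]

theorem shiftWord_one (x : List (Fin (k + 2))) :
    shiftWord (1 :: x) = 0 :: Fin.last (k + 1) :: x := by
  simp [shiftWord]

theorem shiftWord_of_two_le {a : Fin (k + 2)} (h : 2 ≤ a.1) (x : List (Fin (k + 2))) :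
    shiftWord (a :: x) = ⟨a.1 - 1, by omega⟩ :: x := by
  rw [shiftWord, if_neg, if_neg]
  · rintro rfl; simp at h
  · rintro rfl; simp at h

theorem letter_cases (a : Fin (k + 2)) : a = 0 ∨ a = 1 ∨ 2 ≤ a.1 := by
  rcases a with ⟨_ | _ | a, h⟩
  · exact Or.inl rfl
  · exact Or.inr (Or.inl rfl)
  · exact Or.inr (Or.inr (by simp))

theorem lcp_last_shiftWord (x y : List (Fin (k + 2))) :
    lcp (shiftWord x) (Fin.last (k + 1) :: y) = 0 := by
  have h0 : (0 : Fin (k + 2)) ≠ Fin.last (k + 1) := by simp [Fin.ext_iff]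
  cases x with
  | nil => simp [shiftWord]
  | cons a x =>
    rcases letter_cases a with rfl | rfl | h
    · rw [shiftWord_zero, lcp_cons, if_neg h0]
    · rw [shiftWord_one, lcp_cons, if_neg h0]
    · rw [shiftWord_of_two_le h, lcp_cons, if_neg]
      simp [Fin.ext_iff]; omega

theorem lcp_comm {α : Type*} [DecidableEq α] (x y : List α) : lcp x y = lcp y x :=
  eq_of_forall_le_iff fun n => by rw [le_lcp_iff, le_lcp_iff]; tauto

/-- Only the first nonzero letter is altered, and at most one letter is inserted there, so a common
prefix gains or loses at most one letter. -/
theorem lcp_shiftWord (x y : List (Fin (k + 2))) :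
    |(lcp (shiftWord x) (shiftWord y) : ℤ) - lcp x y| ≤ 1 := by
  have h01 : (0 : Fin (k + 2)) ≠ 1 := by simp
  induction x generalizing y with
  | nil => simp [shiftWord]
  | cons a x ih =>
    cases y with
    | nil => simp [shiftWord]
    | cons b y =>
      rcases letter_cases a with rfl | rfl | ha <;> rcases letter_cases b with rfl | rfl | hb
      · simpa [shiftWord_zero, lcp_cons] using ih y
      · simp [shiftWord_zero, shiftWord_one, lcp_cons, lcp_last_shiftWord]
      · rw [shiftWord_zero, shiftWord_of_two_le hb, lcp_cons, lcp_cons, if_neg, if_neg]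
        · simp
        · rintro rfl; simp at hb
        · simp [Fin.ext_iff]; omega
      · simp [shiftWord_zero, shiftWord_one, lcp_cons, lcp_last_shiftWord,
          lcp_comm (Fin.last (k + 1) :: x)]
      · simp [shiftWord_one, lcp_cons]
      · rw [shiftWord_one, shiftWord_of_two_le hb, lcp_cons, lcp_cons, if_neg, if_neg]
        · simp
        · rintro rfl; simp at hb
        · simp [Fin.ext_iff]; omega
      · rw [shiftWord_zero, shiftWord_of_two_le ha, lcp_cons, lcp_cons, if_neg, if_neg]
        · simp
        · rintro rfl; simp at ha
        · simp [Fin.ext_iff]; omega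
      · rw [shiftWord_one, shiftWord_of_two_le ha, lcp_cons, lcp_cons, if_neg, if_neg]
        · simp
        · rintro rfl; simp at ha
        · simp [Fin.ext_iff]; omega
      · rw [shiftWord_of_two_le ha, shiftWord_of_two_le hb, lcp_cons, lcp_cons]
        by_cases hab : a = b
        · simp [hab]
        · rw [if_neg hab, if_neg]
          · simp
          · simp only [Fin.ext_iff] at hab ⊢; omega

theorem shiftWord_injective : Function.Injective (shiftWord (k := k)) := by
  have h0 : (0 : Fin (k + 2)) ≠ Fin.last (k + 1) := by simp [Fin.ext_iff]
  have key : ∀ x y : List (Fin (k + 2)), shiftWord x ≠ Fin.last (k + 1) :: y := by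
    intro x y h
    have h1 := lcp_last_shiftWord x y
    rw [h, lcp_self] at h1
    simp at h1
  intro x
  induction x with
  | nil =>
    intro y h
    cases y with
    | nil => rfl
    | cons b y =>
      rcases letter_cases b with rfl | rfl | hb
      · simp [shiftWord] at h
      · simp [shiftWord] at h
      · rw [shiftWord_of_two_le hb] at h; simp [shiftWord] at h
  | cons a x ih =>
    intro y h
    cases y with
    | nil =>
      rcases letter_cases a with rfl | rfl | ha
      · simp [shiftWord] at h
      · simp [shiftWord] at h
      · rw [shiftWord_of_two_le ha] at h; simp [shiftWord] at h
    | cons b y =>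
      rcases letter_cases a with rfl | rfl | ha <;> rcases letter_cases b with rfl | rfl | hb
      · simp only [shiftWord_zero, List.cons.injEq, true_and] at h
        rw [ih h]
      · simp only [shiftWord_zero, shiftWord_one, List.cons.injEq, true_and] at h
        exact (key _ _ h).elim
      · rw [shiftWord_zero, shiftWord_of_two_le hb] at h
        simp [Fin.ext_iff] at h; omega
      · simp only [shiftWord_zero, shiftWord_one, List.cons.injEq, true_and] at h
        exact (key _ _ h.symm).elim
      · simpa [shiftWord_one] using h
      · rw [shiftWord_one, shiftWord_of_two_le hb] at h
        simp [Fin.ext_iff] at h; omega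
      · rw [shiftWord_zero, shiftWord_of_two_le ha] at h
        simp [Fin.ext_iff] at h; omega
      · rw [shiftWord_one, shiftWord_of_two_le ha] at h
        simp [Fin.ext_iff] at h; omega
      · rw [shiftWord_of_two_le ha, shiftWord_of_two_le hb] at h
        simp only [List.cons.injEq, Fin.ext_iff] at h ⊢
        exact ⟨by omega, h.2⟩

/-- The words missed by `shiftWord` are those that begin with the last letter; they leave room for
one further copy of the tree. -/
theorem shiftWord_surjective (w : List (Fin (k + 2))) :
    (∃ x, w = Fin.last (k + 1) :: x) ∨ ∃ x, shiftWord x = w := by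
  induction w with
  | nil => exact Or.inr ⟨[], rfl⟩
  | cons a w ih =>
    by_cases hl : a = Fin.last (k + 1)
    · exact Or.inl ⟨w, by rw [hl]⟩
    · right
      by_cases h0 : a = 0
      · subst h0
        -- A tail that begins with the last letter can only come from a word beginning with 1.
        obtain ⟨x, rfl⟩ | ⟨x, rfl⟩ := ih
        · exact ⟨1 :: x, shiftWord_one x⟩
        · exact ⟨0 :: x, shiftWord_zero x⟩
      · have h1 : a.1 < k + 1 := by
          have := a.2
          have h2 : a.1 ≠ k + 1 := fun h => hl (Fin.ext h)
          omega
        have h2 : 0 < a.1 := Nat.pos_of_ne_zero fun h => h0 (Fin.ext h)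
        refine ⟨⟨a.1 + 1, by omega⟩ :: w, ?_⟩
        rw [shiftWord_of_two_le (by simp; omega)]
        simp

/-- The copy `i₀` is squeezed by `shiftWord` into the words that do not begin with the last letter,
and the additional copy is hung below the last letter of copy `i₀`. -/
theorem roughEquiv_option {ι : Type*} [DecidableEq ι] (i₀ : ι) :
    RoughEquiv (copyMeet (ι := Option ι) (α := Fin (k + 2)))
      (copyMeet (ι := ι) (α := Fin (k + 2))) := by
  let f : Option ι × List (Fin (k + 2)) → ι × List (Fin (k + 2)) := fun p =>
    match p.1 with
    | none => (i₀, Fin.last (k + 1) :: p.2)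
    | some i => if i = i₀ then (i, shiftWord p.2) else (i, p.2)
  have f0 : ∀ x, f (none, x) = (i₀, Fin.last (k + 1) :: x) := fun x => rfl
  have f1 : ∀ x, f (some i₀, x) = (i₀, shiftWord x) := fun x => by simp [f]
  have f2 : ∀ i x, i ≠ i₀ → f (some i, x) = (i, x) := fun i x h => by simp [f, h]
  have key : ∀ x y : List (Fin (k + 2)), shiftWord x ≠ Fin.last (k + 1) :: y := by
    intro x y h
    have h1 := lcp_last_shiftWord x y
    rw [h, lcp_self] at h1
    simp at h1
  have hf : Function.Bijective f := by
    constructor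
    · rintro ⟨_ | i, x⟩ ⟨_ | j, y⟩ h
      · simpa [f0] using h
      · by_cases hj : j = i₀
        · subst hj; rw [f0, f1] at h; simp at h; exact (key _ _ h.symm).elim
        · rw [f0, f2 _ _ hj] at h; simp at h; exact (hj h.1.symm).elim
      · by_cases hj : i = i₀
        · subst hj; rw [f0, f1] at h; simp at h; exact (key _ _ h).elim
        · rw [f0, f2 _ _ hj] at h; simp at h; exact (hj h.1).elim
      · by_cases hi : i = i₀ <;> by_cases hj : j = i₀
        · subst hi; subst hj; rw [f1, f1] at h; simp at h; rw [shiftWord_injective h]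
        · subst hi; rw [f1, f2 _ _ hj] at h; simp at h; exact (hj h.1.symm).elim
        · subst hj; rw [f1, f2 _ _ hi] at h; simp at h; exact (hi h.1).elim
        · rw [f2 _ _ hi, f2 _ _ hj] at h; simpa using h
    · rintro ⟨i, w⟩
      by_cases hi : i = i₀
      · subst hi
        obtain ⟨x, rfl⟩ | ⟨x, rfl⟩ := shiftWord_surjective w
        · exact ⟨(none, x), f0 x⟩
        · exact ⟨(some i, x), f1 x⟩
      · exact ⟨(some i, w), f2 _ _ hi⟩
  refine ⟨Equiv.ofBijective f hf, 1, ?_⟩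
  rintro ⟨_ | i, x⟩ ⟨_ | j, y⟩
  · simp [f0, copyMeet, lcp_cons]
  · by_cases hj : j = i₀
    · subst hj; simp [f0, f1, copyMeet, lcp_comm _ (shiftWord y), lcp_last_shiftWord]
    · simp [f0, f2 _ _ hj, copyMeet, Ne.symm hj]
  · by_cases hj : i = i₀
    · subst hj; simp [f0, f1, copyMeet, lcp_last_shiftWord]
    · simp [f0, f2 _ _ hj, copyMeet, hj]
  · by_cases hi : i = i₀ <;> by_cases hj : j = i₀
    · subst hi; subst hj
      simpa [f1, copyMeet] using lcp_shiftWord x y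
    · subst hi; simp [f1, f2 _ _ hj, copyMeet, Ne.symm hj]
    · subst hj; simp [f1, f2 _ _ hi, copyMeet, hi]
    · simp [f2 _ _ hi, f2 _ _ hj, copyMeet]

theorem roughEquiv_congr {ι κ : Type*} [DecidableEq ι] [DecidableEq κ] {α : Type*} [DecidableEq α]
    (e : ι ≃ κ) : RoughEquiv (copyMeet (ι := ι) (α := α)) (copyMeet (ι := κ) (α := α)) :=
  ⟨e.prodCongr (Equiv.refl _), 0, by simp [copyMeet]⟩

/-- Finitely many copies of the tree of words are roughly equivalent to one copy. -/
theorem roughEquiv_copies {n : ℕ} (hn : 1 ≤ n) (hN : 2 ≤ N ∨ n = 1) :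
    RoughEquiv (copyMeet (ι := Fin n) (α := Fin N)) (lcp (α := Fin N)) := by
  have h1 : RoughEquiv (copyMeet (ι := Fin 1) (α := Fin N)) (lcp (α := Fin N)) :=
    -- The constant 1 is the edge to the additional root, which `copyMeet` counts and `lcp` does
    -- not.
    ⟨Equiv.uniqueProd (List (Fin N)) (Fin 1), 1, by
      rintro ⟨i, x⟩ ⟨j, y⟩
      simp [copyMeet, Subsingleton.elim i j]⟩
  obtain hN | rfl := hN
  · obtain ⟨k, rfl⟩ := Nat.exists_eq_add_of_le' hN
    induction n, hn using Nat.le_induction with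
    | base => exact h1
    | succ n hn ih =>
      have : NeZero n := ⟨by omega⟩
      exact ((roughEquiv_congr (finSuccEquiv n)).trans (roughEquiv_option 0)).trans ih
  · exact h1

end Copies

/-- The distance of the connected graph `G` is given, up to the constant `M`, by the levels
`m x x` and the products `m x y`, as in a rooted tree. -/
structure HasMeet {V : Type*} (G : SimpleGraph V) (m : V → V → ℕ) (M : ℕ) : Prop where
  connected : G.Connected
  meet_le : ∀ x y, m x y ≤ m x x
  le_dist : ∀ x y, (m x x : ℤ) + m y y - 2 * m x y ≤ G.dist x y
  dist_le : ∀ x y, (G.dist x y : ℤ) ≤ m x x + m y y - 2 * m x y + M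

/-! ### Tree-like graphs and their hyperbolicity -/

namespace HasMeet

variable {V : Type*} {G : SimpleGraph V} {m : V → V → ℕ} {M : ℕ}

/-- Inserting the formula for the distances gives `m x y + m o o - m o x - m o y` up to the errors
`M`, and both `m o x` and `m o y` lie between 0 and `m o o`. Changing the root thus costs only a
constant. -/
theorem abs_gromovProduct_sub_le (h : HasMeet G m M) (o x y : V) :
    |gromovProduct G o x y - m x y| ≤ m o o + 2 * M := by
  have a1 : (m o o : ℝ) + m x x - 2 * m o x ≤ G.dist o x := by exact_mod_cast h.le_dist o x
  have a2 : (m o o : ℝ) + m y y - 2 * m o y ≤ G.dist o y := by exact_mod_cast h.le_dist o y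
  have a3 : (m x x : ℝ) + m y y - 2 * m x y ≤ G.dist x y := by exact_mod_cast h.le_dist x y
  have b1 : (G.dist o x : ℝ) ≤ m o o + m x x - 2 * m o x + M := by exact_mod_cast h.dist_le o x
  have b2 : (G.dist o y : ℝ) ≤ m o o + m y y - 2 * m o y + M := by exact_mod_cast h.dist_le o y
  have b3 : (G.dist x y : ℝ) ≤ m x x + m y y - 2 * m x y + M := by exact_mod_cast h.dist_le x y
  have c1 : (m o x : ℝ) ≤ m o o := by exact_mod_cast h.meet_le o x
  have c2 : (m o y : ℝ) ≤ m o o := by exact_mod_cast h.meet_le o y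
  have d1 : (0 : ℝ) ≤ m o x := by positivity
  have d2 : (0 : ℝ) ≤ m o y := by positivity
  have d3 : (0 : ℝ) ≤ M := by positivity
  unfold gromovProduct
  rw [abs_le]
  constructor <;> linarith

theorem isHyperbolicGraph (h : HasMeet G m M) (hm : ∀ x y z, min (m x z) (m z y) ≤ m x y) (o : V) :
    IsHyperbolicGraph G o := by
  refine ⟨2 * (m o o + 2 * M), by positivity, fun x y z => ?_⟩
  have h1 := (abs_le.1 (h.abs_gromovProduct_sub_le o x y)).1
  have h2 := (abs_le.1 (h.abs_gromovProduct_sub_le o x z)).2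
  have h3 := (abs_le.1 (h.abs_gromovProduct_sub_le o z y)).2
  rcases min_le_iff.1 (hm x y z) with h4 | h4
  · have h5 : (m x z : ℝ) ≤ m x y := by exact_mod_cast h4
    linarith [min_le_left (gromovProduct G o x z) (gromovProduct G o z y)]
  · have h5 : (m z y : ℝ) ≤ m x y := by exact_mod_cast h4
    linarith [min_le_right (gromovProduct G o x z) (gromovProduct G o z y)]

end HasMeet

theorem reachable_and_dist_le_of_chain {V : Type*} {G : SimpleGraph V} (q : ℕ → V) (n : ℕ)
    (h : ∀ j < n, G.Adj (q j) (q (j + 1))) :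
    G.Reachable (q 0) (q n) ∧ G.dist (q 0) (q n) ≤ n := by
  have : ∃ p : G.Walk (q 0) (q n), p.length = n := by
    induction n with
    | zero => exact ⟨.nil, rfl⟩
    | succ n ih =>
      obtain ⟨p, hp⟩ := ih fun j hj => h j (by omega)
      exact ⟨p.concat (h n (by omega)), by simp [hp]⟩
  obtain ⟨p, hp⟩ := this
  exact ⟨p.reachable, (SimpleGraph.dist_le p).trans hp.le⟩

/-! ### The tree of words and its unions of copies are exactly tree-like -/

section NaryTree

variable {N : ℕ}

theorem naryTree_adj_iff {x y : List (Fin N)} :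
    (naryTree N).Adj x y ↔ (∃ i, x = y ++ [i]) ∨ ∃ i, y = x ++ [i] := by
  have key : ∀ x y : List (Fin N), (x ≠ [] ∧ x.dropLast = y) ↔ ∃ i, x = y ++ [i] := by
    intro x y
    constructor
    · rintro ⟨h, rfl⟩
      exact ⟨x.getLast h, (List.dropLast_append_getLast h).symm⟩
    · rintro ⟨i, rfl⟩
      simp
  change ((x ≠ [] ∧ x.dropLast = y) ∨ (y ≠ [] ∧ y.dropLast = x)) ↔ _
  rw [key, key]

theorem naryTree_adj_append (x : List (Fin N)) (i : Fin N) : (naryTree N).Adj x (x ++ [i]) :=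
  naryTree_adj_iff.2 (Or.inr ⟨i, rfl⟩)

theorem naryTree_adj_take {x : List (Fin N)} {n : ℕ} (h : n < x.length) :
    (naryTree N).Adj (x.take n) (x.take (n + 1)) := by
  rw [List.take_add_one, List.getElem?_eq_getElem h]
  exact naryTree_adj_append _ _

/-- This is the lower bound for the distance in infinitesimal form: summed along a path from `x` by
`sub_le_dist_of_adj`, it bounds the path length below by the tree formula. -/
theorem length_sub_lcp_of_adj (x : List (Fin N)) {y z : List (Fin N)} (h : (naryTree N).Adj y z) :
    (z.length : ℤ) - 2 * lcp x z ≤ y.length - 2 * lcp x y + 1 := by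
  rcases naryTree_adj_iff.1 h with ⟨i, rfl⟩ | ⟨i, rfl⟩
  · have := lcp_append_le x z i
    simp; omega
  · have := lcp_le_append x y i
    simp; omega

theorem hasMeet_naryTree (N : ℕ) : HasMeet (naryTree N) lcp 0 := by
  have chain : ∀ (x : List (Fin N)) n, n ≤ x.length →
      (naryTree N).Reachable (x.take n) x ∧ (naryTree N).dist (x.take n) x ≤ x.length - n := by
    intro x n hn
    have h := reachable_and_dist_le_of_chain (G := naryTree N) (fun j => x.take (n + j))
      (x.length - n) fun j hj => naryTree_adj_take (by omega)
    simpa [Nat.add_sub_cancel' hn] using h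
  have conn : (naryTree N).Connected := by
    have : ∀ x, (naryTree N).Reachable [] x := fun x => by
      simpa using (chain x 0 (Nat.zero_le _)).1
    exact { preconnected := fun x y => (this x).symm.trans (this y), nonempty := ⟨[]⟩ }
  refine ⟨conn, fun x y => ?_, fun x y => ?_, fun x y => ?_⟩
  · rw [lcp_self]; exact lcp_le_left x y
  · have h := sub_le_dist_of_adj (G := naryTree N) (f := fun y => (y.length : ℤ) - 2 * lcp x y)
      (fun y z => length_sub_lcp_of_adj x) (conn x y)
    simp only [lcp_self] at h ⊢
    linarith
  · obtain ⟨h1, h2, h3⟩ := le_lcp_iff.1 (le_refl (lcp x y))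
    have a1 := (chain x _ h1).2
    have a2 := (chain y _ h2).2
    have a3 : (naryTree N).dist x y ≤ (naryTree N).dist x (x.take (lcp x y)) +
      (naryTree N).dist (x.take (lcp x y)) y := conn.dist_triangle
    rw [SimpleGraph.dist_comm (u := x) (v := x.take (lcp x y)), h3] at a3
    rw [h3] at a1
    rw [lcp_self, lcp_self]
    omega

/-- The product on the union of copies of the tree of words. -/
def optionCopyMeet {ℓ : ℕ} : Option (Fin ℓ × List (Fin N)) → Option (Fin ℓ × List (Fin N)) → ℕ
  | some p, some q => copyMeet p q
  | _, _ => 0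

/-- The additional vertex has level 0 and the root of each copy level 1, so the union is again a
rooted tree and the formula has no error. -/
theorem hasMeet_copiesUnion (N ℓ : ℕ) :
    HasMeet (copiesUnion (naryTree N) [] ℓ) optionCopyMeet 0 := by
  set G := copiesUnion (naryTree N) [] ℓ with hG
  have chain : ∀ (i : Fin ℓ) (x : List (Fin N)) n, n ≤ x.length →
      G.Reachable (some (i, x.take n)) (some (i, x)) ∧
        G.dist (some (i, x.take n)) (some (i, x)) ≤ x.length - n := by
    intro i x n hn
    have h := reachable_and_dist_le_of_chain (G := G) (fun j => some (i, x.take (n + j)))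
      (x.length - n) fun j hj => ⟨rfl, naryTree_adj_take (by omega)⟩
    simpa [Nat.add_sub_cancel' hn] using h
  have adj0 : ∀ i : Fin ℓ, G.Adj none (some (i, [])) := fun i => rfl
  have conn : G.Connected := by
    have : ∀ x, G.Reachable none x := fun x => by
      rcases x with _ | ⟨i, x⟩
      · exact SimpleGraph.Reachable.refl _
      · exact (adj0 i).reachable.trans (by simpa using (chain i x 0 (Nat.zero_le _)).1)
    exact { preconnected := fun x y => (this x).symm.trans (this y), nonempty := ⟨none⟩ }
  have root : ∀ i x, G.dist none (some (i, x)) ≤ x.length + 1 := by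
    intro i x
    have h1 : G.dist none (some (i, x)) ≤ G.dist none (some (i, [])) +
      G.dist (some (i, [])) (some (i, x)) := conn.dist_triangle
    have h2 := (chain i x 0 (Nat.zero_le _)).2
    rw [SimpleGraph.dist_eq_one_iff_adj.2 (adj0 i)] at h1
    rw [List.take_zero] at h2
    omega
  have self : ∀ (i : Fin ℓ) (x : List (Fin N)),
      optionCopyMeet (some (i, x)) (some (i, x)) = x.length + 1 := fun i x => by
    simp [optionCopyMeet, copyMeet, lcp_self]
  have ne : ∀ (i j : Fin ℓ) (x y : List (Fin N)), i ≠ j →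
      optionCopyMeet (some (i, x)) (some (j, y)) = 0 := fun i j x y h => by
    simp [optionCopyMeet, copyMeet, h]
  have eq : ∀ (i : Fin ℓ) (x y : List (Fin N)),
      optionCopyMeet (some (i, x)) (some (i, y)) = lcp x y + 1 := fun i x y => by
    simp [optionCopyMeet, copyMeet]
  have none_left : ∀ p : Option (Fin ℓ × List (Fin N)), optionCopyMeet none p = 0 := fun p => by
    simp [optionCopyMeet]
  have none_right : ∀ p : Option (Fin ℓ × List (Fin N)), optionCopyMeet p none = 0 := fun p => by
    simp [optionCopyMeet]
  refine ⟨conn, fun x y => ?_, fun x y => ?_, fun x y => ?_⟩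
  · rcases x with _ | ⟨i, x⟩
    · simp [none_left]
    rcases y with _ | ⟨j, y⟩
    · simp [none_right]
    by_cases hij : i = j
    · subst hij; rw [self, eq]; have := lcp_le_left x y; omega
    · simp [ne _ _ _ _ hij]
  · have h := sub_le_dist_of_adj (G := G)
      (f := fun y => (optionCopyMeet y y : ℤ) - 2 * optionCopyMeet x y) ?_ (conn x y)
    · linarith
    rintro (_ | ⟨i, y⟩) (_ | ⟨j, z⟩) hyz
    · exact (G.loopless.irrefl _ hyz).elim
    · obtain rfl : z = [] := hyz
      simp [none_right, self]
    · obtain rfl : y = [] := hyz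
      simp only [none_right, self]
      rcases x with _ | ⟨i', x⟩
      · simp [none_left]
      · by_cases hi : i' = i
        · subst hi; simp [eq]
        · simp [ne _ _ _ _ hi]
    · obtain ⟨rfl, hadj⟩ : i = j ∧ (naryTree N).Adj y z := hyz
      simp only [self]
      rcases x with _ | ⟨i', x⟩
      -- With the empty word all common prefixes vanish, so this says that lengths grow by at most
      -- one along an edge.
      · have := length_sub_lcp_of_adj [] hadj
        simp at this
        simp [none_left]; omega
      · by_cases hi : i' = i
        · subst hi
          have := length_sub_lcp_of_adj x hadj
          simp [eq]; omega
        · have := length_sub_lcp_of_adj [] hadj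
          simp at this
          simp [ne _ _ _ _ hi]; omega
  · rcases x with _ | ⟨i, x⟩ <;> rcases y with _ | ⟨j, y⟩
    · simp [none_left]
    · have := root j y
      simp only [none_left, self]; omega
    · have := root i x
      rw [SimpleGraph.dist_comm] at this
      simp only [none_left, none_right, self]; omega
    · by_cases hij : i = j
      · subst hij
        obtain ⟨h1, h2, h3⟩ := le_lcp_iff.1 (le_refl (lcp x y))
        have a1 := (chain i x _ h1).2
        have a2 := (chain i y _ h2).2
        have a3 : G.dist (some (i, x)) (some (i, y)) ≤
          G.dist (some (i, x)) (some (i, x.take (lcp x y))) +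
          G.dist (some (i, x.take (lcp x y))) (some (i, y)) := conn.dist_triangle
        rw [SimpleGraph.dist_comm (u := some (i, x)) (v := some (i, x.take (lcp x y))), h3] at a3
        rw [h3] at a1
        rw [self, self, eq]
        omega
      · have a1 : G.dist (some (i, x)) (some (j, y)) ≤ G.dist (some (i, x)) none +
          G.dist none (some (j, y)) := conn.dist_triangle
        rw [SimpleGraph.dist_comm (u := some (i, x)) (v := none)] at a1
        have a2 := root i x
        have a3 := root j y
        rw [self, self, ne _ _ _ _ hij]
        omega

end NaryTree

/-! ### The tree of horizontal components -/

namespace AugmentedTree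

variable {N : ℕ} {X : AugmentedTree N}

/-- The horizontal component of a word. -/
abbrev comp (X : AugmentedTree N) (x : List (Fin N)) : X.Component :=
  X.horizontal.connectedComponentMk x

/-- Iterates the axiom `pred` up to level `n`. It makes truncation well defined on components. -/
theorem adj_take {x y : List (Fin N)} (h : X.horizontal.Adj x y) (n : ℕ) :
    x.take n = y.take n ∨ X.horizontal.Adj (x.take n) (y.take n) := by
  have key : ∀ k (x y : List (Fin N)), X.horizontal.Adj x y → x.length ≤ n + k →
      x.take n = y.take n ∨ X.horizontal.Adj (x.take n) (y.take n) := by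
    intro k
    induction k with
    | zero =>
      intro x y h hk
      rw [Nat.add_zero] at hk
      rw [List.take_of_length_le hk, List.take_of_length_le (X.length_eq _ _ h ▸ hk)]
      exact Or.inr h
    | succ k ih =>
      intro x y h hk
      have hl := X.length_eq _ _ h
      by_cases hn : x.length ≤ n
      · rw [List.take_of_length_le hn, List.take_of_length_le (hl ▸ hn)]
        exact Or.inr h
      have e : ∀ z : List (Fin N), z.length = x.length → z.dropLast.take n = z.take n := by
        intro z hz
        rw [List.dropLast_eq_take, List.take_take, min_eq_left (by omega)]
      rw [← e x rfl, ← e y hl.symm]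
      rcases X.pred _ _ h with h1 | h1
      · exact Or.inl (by rw [h1])
      · exact ih _ _ h1 (by simp; omega)
  exact key x.length x y h (by omega)

theorem exists_comp (S : X.Component) : ∃ x, X.comp x = S := Quot.exists_rep S

/-- The common length of the words of a component. -/
def level (S : X.Component) : ℕ :=
  SimpleGraph.ConnectedComponent.recOn (motive := fun _ => ℕ) S List.length (by
    intro x y p _
    have : x.length = y.length := by
      induction p with
      | nil => rfl
      | cons h p ih =>
        rename_i hp
        exact (X.length_eq _ _ h).trans (ih hp.of_cons)
    simpa using this)

@[simp] theorem level_comp (x : List (Fin N)) : level (X.comp x) = x.length := rfl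

/-- The component of the ancestors of level `n` of a component. -/
def trunc (n : ℕ) (S : X.Component) : X.Component :=
  SimpleGraph.ConnectedComponent.lift (fun x => X.comp (x.take n)) (by
    intro x y p _
    induction p with
    | nil => rfl
    | cons h p ih =>
      rename_i hp
      refine Eq.trans ?_ (ih hp.of_cons)
      rcases adj_take h n with h1 | h1
      · rw [h1]
      · exact SimpleGraph.ConnectedComponent.connectedComponentMk_eq_of_adj h1) S

@[simp] theorem trunc_comp (n : ℕ) (x : List (Fin N)) : trunc n (X.comp x) = X.comp (x.take n) :=
  rfl

@[simp] theorem level_trunc (n : ℕ) (S : X.Component) : level (trunc n S) = min n (level S) := by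
  obtain ⟨x, rfl⟩ := exists_comp S
  simp

theorem trunc_trunc (n k : ℕ) (S : X.Component) : trunc n (trunc k S) = trunc (min n k) S := by
  obtain ⟨x, rfl⟩ := exists_comp S
  simp [List.take_take]

theorem trunc_of_level_le {n : ℕ} {S : X.Component} (h : level S ≤ n) : trunc n S = S := by
  obtain ⟨x, rfl⟩ := exists_comp S
  rw [trunc_comp, List.take_of_length_le h]

theorem mem_supp {S : X.Component} {x : List (Fin N)} : x ∈ S.supp ↔ X.comp x = S := Iff.rfl

theorem comp_take_congr {x y : List (Fin N)} (h : X.comp x = X.comp y) (n : ℕ) :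
    X.comp (x.take n) = X.comp (y.take n) := congrArg (trunc n) h

theorem length_eq_of_comp_eq {x y : List (Fin N)} (h : X.comp x = X.comp y) :
    x.length = y.length := congrArg level h

theorem finite_supp (S : X.Component) : S.supp.Finite := by
  refine (List.finite_length_eq (Fin N) (level S)).subset fun x hx => ?_
  rw [mem_supp] at hx
  simp [← hx]

theorem mem_descendants_iff {T : X.Component} {x : List (Fin N)} :
    x ∈ descendants T ↔ X.comp (x.take (level T)) = T := by
  constructor
  · rintro ⟨y, hy, hyx⟩
    rw [mem_supp] at hy
    rw [← hy, level_comp, ← List.prefix_iff_eq_take.1 hyx]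
  · intro h
    exact ⟨_, h, List.take_prefix _ _⟩

theorem level_le_of_mem_descendants {T : X.Component} {x : List (Fin N)}
    (hx : x ∈ descendants T) : level T ≤ x.length := by
  have := congrArg level (mem_descendants_iff.1 hx)
  simp at this
  omega

theorem take_mem_descendants {T : X.Component} {x : List (Fin N)} (hx : x ∈ descendants T) {n : ℕ}
    (hn : level T ≤ n) : x.take n ∈ descendants T := by
  rw [mem_descendants_iff, List.take_take, min_eq_left hn]
  exact mem_descendants_iff.1 hx

theorem append_mem_descendants {T : X.Component} {x : List (Fin N)} (hx : x ∈ descendants T)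
    (w : List (Fin N)) : x ++ w ∈ descendants T := by
  rw [mem_descendants_iff, List.take_append_of_le_length (level_le_of_mem_descendants hx)]
  exact mem_descendants_iff.1 hx

theorem mem_descendants_of_comp_eq {T : X.Component} {x y : List (Fin N)} (hx : x ∈ descendants T)
    (h : X.comp x = X.comp y) : y ∈ descendants T := by
  rw [mem_descendants_iff] at hx ⊢
  exact (comp_take_congr h _).symm.trans hx

theorem supp_subset_descendants_iff {S T : X.Component} :
    S.supp ⊆ descendants T ↔ trunc (level T) S = T := by
  obtain ⟨x, rfl⟩ := exists_comp S
  constructor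
  · intro h
    exact mem_descendants_iff.1 (h (rfl : X.comp x = X.comp x))
  · intro h y hy
    rw [mem_supp] at hy
    rw [mem_descendants_iff, ← trunc_comp, hy, h]

open scoped Classical in
/-- The largest level at which the ancestors of two words lie in the same component. -/
noncomputable def meet (X : AugmentedTree N) (x y : List (Fin N)) : ℕ :=
  Nat.findGreatest (fun n => X.comp (x.take n) = X.comp (y.take n)) (min x.length y.length)

/-- Words in a common component have their ancestors in a common component (`comp_take_congr`), so
the admissible levels form an initial segment. -/
theorem le_meet_iff {n : ℕ} {x y : List (Fin N)} :
    n ≤ X.meet x y ↔ n ≤ x.length ∧ n ≤ y.length ∧ X.comp (x.take n) = X.comp (y.take n) := by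
  classical
  constructor
  · intro h
    have h1 := Nat.findGreatest_le (P := fun n => X.comp (x.take n) = X.comp (y.take n))
      (min x.length y.length)
    have h2 : X.comp (x.take (X.meet x y)) = X.comp (y.take (X.meet x y)) :=
      Nat.findGreatest_spec (P := fun n => X.comp (x.take n) = X.comp (y.take n))
        (Nat.zero_le _) (by simp)
    have h3 : X.meet x y ≤ min x.length y.length := h1
    refine ⟨by omega, by omega, ?_⟩
    have h4 := comp_take_congr h2 n
    rwa [List.take_take, List.take_take, min_eq_left h] at h4
  · rintro ⟨h1, h2, h3⟩
    exact Nat.le_findGreatest (le_min h1 h2) h3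

theorem meet_self (x : List (Fin N)) : X.meet x x = x.length :=
  le_antisymm (le_meet_iff.1 le_rfl).1 (le_meet_iff.2 ⟨le_rfl, le_rfl, rfl⟩)

theorem meet_le_left (x y : List (Fin N)) : X.meet x y ≤ x.length := (le_meet_iff.1 le_rfl).1

/-- Lying in the same component is transitive, so `meet` satisfies the ultrametric inequality
without any error. -/
theorem min_meet_le (x y z : List (Fin N)) : min (X.meet x z) (X.meet z y) ≤ X.meet x y := by
  obtain ⟨a1, a2, a3⟩ := le_meet_iff.1 (min_le_left (X.meet x z) (X.meet z y))
  obtain ⟨b1, b2, b3⟩ := le_meet_iff.1 (min_le_right (X.meet x z) (X.meet z y))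
  exact le_meet_iff.2 ⟨a1, b2, a3.trans b3⟩

theorem meet_le_append (x y : List (Fin N)) (i : Fin N) : X.meet x y ≤ X.meet x (y ++ [i]) := by
  obtain ⟨h1, h2, h3⟩ := le_meet_iff.1 (le_refl (X.meet x y))
  refine le_meet_iff.2 ⟨h1, by simp; omega, ?_⟩
  rw [h3, List.take_append_of_le_length h2]

theorem meet_append_le (x y : List (Fin N)) (i : Fin N) :
    X.meet x (y ++ [i]) ≤ X.meet x y + 1 := by
  obtain ⟨h1, h2, h3⟩ := le_meet_iff.1 (le_refl (X.meet x (y ++ [i])))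
  rw [← tsub_le_iff_right]
  rw [List.length_append, List.length_singleton] at h2
  refine le_meet_iff.2 ⟨by omega, by omega, ?_⟩
  have h4 := comp_take_congr h3 (X.meet x (y ++ [i]) - 1)
  rw [List.take_take, List.take_take, min_eq_left (by omega),
    List.take_append_of_le_length (by omega)] at h4
  exact h4

theorem meet_congr_right {y z : List (Fin N)} (x : List (Fin N)) (h : X.comp y = X.comp z) :
    X.meet x y = X.meet x z :=
  eq_of_forall_le_iff fun n => by
    rw [le_meet_iff, le_meet_iff, length_eq_of_comp_eq h, comp_take_congr h]

/-- A horizontal edge changes neither the level nor `meet`; along a vertical edge the argument is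
the one for the tree of words. -/
theorem length_sub_meet_of_adj (x : List (Fin N)) {y z : List (Fin N)} (h : X.graph.Adj y z) :
    (z.length : ℤ) - 2 * X.meet x z ≤ y.length - 2 * X.meet x y + 1 := by
  rcases h with h | h
  · rcases naryTree_adj_iff.1 h with ⟨i, rfl⟩ | ⟨i, rfl⟩
    · have := X.meet_append_le x z i
      simp; omega
    · have := X.meet_le_append x y i
      simp; omega
  · rw [meet_congr_right x (SimpleGraph.ConnectedComponent.connectedComponentMk_eq_of_adj h),
      X.length_eq _ _ h]
    omega

theorem reachable_and_dist_take_le {T : X.Component} (x : descendants T) {n : ℕ}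
    (hT : level T ≤ n) (hn : n ≤ x.1.length) :
    (descendantGraph T).Reachable ⟨x.1.take n, take_mem_descendants x.2 hT⟩ x ∧
      (descendantGraph T).dist ⟨x.1.take n, take_mem_descendants x.2 hT⟩ x ≤ x.1.length - n := by
  have h := reachable_and_dist_le_of_chain (G := descendantGraph T)
    (fun j => ⟨x.1.take (n + j), take_mem_descendants x.2 (by omega)⟩)
    (x.1.length - n) fun j hj => Or.inl (naryTree_adj_take (by omega))
  simpa [Nat.add_sub_cancel' hn] using h

/-- A horizontal path without repeated vertices stays in its component, hence among the descendants
of `T`, and is shorter than the size of the component. -/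
theorem reachable_and_dist_comp_le {T : X.Component} (x y : descendants T)
    (h : X.comp x.1 = X.comp y.1) :
    (descendantGraph T).Reachable x y ∧
      (descendantGraph T).dist x y ≤ (X.comp x.1).supp.ncard := by
  classical
  obtain ⟨p, hp⟩ := (SimpleGraph.ConnectedComponent.exact h).exists_isPath
  have hsupp : ∀ z ∈ p.support, X.comp z = X.comp x.1 := fun z hz =>
    (SimpleGraph.ConnectedComponent.sound (p.takeUntil z hz).reachable).symm
  have hvert : ∀ j, X.comp (p.getVert j) = X.comp x.1 := fun j => hsupp _ (p.getVert_mem_support j)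
  have h1 := reachable_and_dist_le_of_chain (G := descendantGraph T)
    (fun j => ⟨p.getVert j, mem_descendants_of_comp_eq x.2 (hvert j).symm⟩) p.length
    fun j hj => Or.inr (p.adj_getVert_succ hj)
  simp only [SimpleGraph.Walk.getVert_zero, SimpleGraph.Walk.getVert_length] at h1
  refine ⟨h1.1, h1.2.trans ?_⟩
  have h2 : p.support.toFinset.card ≤ (X.comp x.1).supp.ncard := by
    rw [← Set.ncard_coe_finset]
    refine Set.ncard_le_ncard (fun z hz => ?_) (finite_supp _)
    exact hsupp z (by simpa using hz)
  rw [List.toFinset_card_of_nodup hp.support_nodup, SimpleGraph.Walk.length_support] at h2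
  omega

/-- If the horizontal components have bounded size, then the tree of components determines the
graph distance up to a constant. -/
theorem hasMeet_descendantGraph (T : X.Component) {M : ℕ}
    (hM : ∀ S : X.Component, S.supp.ncard ≤ M) :
    HasMeet (descendantGraph T) (fun x y => X.meet x.1 y.1) M := by
  have top : ∀ x : descendants T, X.comp (x.1.take (level T)) = T := fun x =>
    mem_descendants_iff.1 x.2
  have conn : (descendantGraph T).Connected := by
    refine { preconnected := fun x y => ?_, nonempty := ?_ }
    · have hx := (reachable_and_dist_take_le x le_rfl (level_le_of_mem_descendants x.2)).1
      have hy := (reachable_and_dist_take_le y le_rfl (level_le_of_mem_descendants y.2)).1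
      exact hx.symm.trans ((reachable_and_dist_comp_le _ _ ((top x).trans (top y).symm)).1.trans hy)
    · obtain ⟨x, hx⟩ := T.nonempty_supp
      exact ⟨⟨x, x, hx, List.prefix_rfl⟩⟩
  refine ⟨conn, fun x y => ?_, fun x y => ?_, fun x y => ?_⟩
  · rw [meet_self]; exact meet_le_left _ _
  · have h := sub_le_dist_of_adj (G := descendantGraph T)
      (f := fun y => (y.1.length : ℤ) - 2 * X.meet x.1 y.1)
      (fun y z hyz => length_sub_meet_of_adj x.1 hyz) (conn x y)
    simp only [meet_self] at h ⊢
    linarith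
  · obtain ⟨h1, h2, h3⟩ := le_meet_iff.1 (le_refl (X.meet x.1 y.1))
    -- Both words have their ancestor of level `level T` in `T`, so the path up to level `meet`,
    -- across and down does not leave the descendants of `T`.
    have h4 : level T ≤ X.meet x.1 y.1 := le_meet_iff.2 ⟨level_le_of_mem_descendants x.2,
      level_le_of_mem_descendants y.2, (top x).trans (top y).symm⟩
    have a1 := (reachable_and_dist_take_le x h4 h1).2
    have a2 := (reachable_and_dist_take_le y h4 h2).2
    have a3 := (reachable_and_dist_comp_le ⟨x.1.take (X.meet x.1 y.1), take_mem_descendants x.2 h4⟩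
      ⟨y.1.take (X.meet x.1 y.1), take_mem_descendants y.2 h4⟩ h3).2.trans (hM _)
    have b1 := conn.dist_triangle (u := x)
      (v := ⟨x.1.take (X.meet x.1 y.1), take_mem_descendants x.2 h4⟩) (w := y)
    have b2 := conn.dist_triangle (u := ⟨x.1.take (X.meet x.1 y.1), take_mem_descendants x.2 h4⟩)
      (v := ⟨y.1.take (X.meet x.1 y.1), take_mem_descendants y.2 h4⟩) (w := y)
    rw [SimpleGraph.dist_comm] at a1
    rw [meet_self, meet_self]
    omega

end AugmentedTree

/-! ### What equivalences of components preserve -/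

namespace AugmentedTree

variable {N : ℕ} {X : AugmentedTree N}

theorem mem_supp_iff_length {S : X.Component} {x : List (Fin N)} (hx : x ∈ descendants S) :
    x ∈ S.supp ↔ x.length = level S := by
  constructor
  · intro h
    rw [mem_supp] at h
    rw [← h, level_comp]
  · intro h
    rw [mem_descendants_iff, List.take_of_length_le h.le] at hx
    exact hx

theorem supp_subset_descendants (S : X.Component) : S.supp ⊆ descendants S :=
  fun x hx => ⟨x, hx, List.prefix_rfl⟩

/-- The bijections between sets of descendants which, together with their inverses, preserve
vertical and horizontal edges. -/
def IsEdgeIso {S S' : X.Component} (g : descendants S ≃ descendants S') : Prop :=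
  ∀ x y : descendants S,
    ((naryTree N).Adj (x : List (Fin N)) y ↔ (naryTree N).Adj (g x : List (Fin N)) (g y)) ∧
    (X.horizontal.Adj (x : List (Fin N)) y ↔ X.horizontal.Adj (g x : List (Fin N)) (g y))

/-- The vertical neighbours of a word among the descendants of `S`. -/
def verticalNeighbors {S : X.Component} (x : descendants S) : Set (descendants S) :=
  {z | (naryTree N).Adj (x : List (Fin N)) z}

/-- A word of `S` has no predecessor among the descendants of `S`, so the vertical degree recognises
the top level. This matters because an edge isomorphism is not assumed to respect levels or the
direction of vertical edges. -/
theorem ncard_verticalNeighbors {S : X.Component} (x : descendants S) :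
    (verticalNeighbors x).ncard = if x.1.length = level S then N else N + 1 := by
  let f : Fin N → descendants S := fun i => ⟨x.1 ++ [i], append_mem_descendants x.2 _⟩
  have hf : Function.Injective f := fun i j h => by simpa [f] using congrArg Subtype.val h
  have hcard : (Set.range f).ncard = N := by
    rw [← Set.image_univ, Set.ncard_image_of_injective _ hf, Set.ncard_univ, Nat.card_fin]
  have hrange : Set.range f ⊆ verticalNeighbors x := by
    rintro _ ⟨i, rfl⟩
    exact naryTree_adj_append _ _
  split_ifs with h
  · refine (congrArg Set.ncard ?_).trans hcard
    refine Set.Subset.antisymm (fun z hz => ?_) hrange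
    rcases naryTree_adj_iff.1 hz with ⟨i, hi⟩ | ⟨i, hi⟩
    · have h1 := level_le_of_mem_descendants z.2
      rw [hi] at h
      simp at h; omega
    · exact ⟨i, Subtype.ext hi.symm⟩
  · have hlt : level S < x.1.length :=
      lt_of_le_of_ne (level_le_of_mem_descendants x.2) (Ne.symm h)
    have hne : x.1 ≠ [] := by
      intro h0; rw [h0] at hlt; simp at hlt
    let p : descendants S :=
      ⟨x.1.take (x.1.length - 1), take_mem_descendants x.2 (by omega)⟩
    have hp : p.1 = x.1.dropLast := List.dropLast_eq_take.symm
    have hpr : p ∉ Set.range f := by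
      rintro ⟨i, hi⟩
      have := congrArg (fun z : descendants S => z.1.length) hi
      simp [f, hp] at this
      omega
    have hcard' : (insert p (Set.range f)).ncard = N + 1 := by
      rw [Set.ncard_insert_of_notMem hpr (Set.finite_range f), hcard]
    refine (congrArg Set.ncard ?_).trans hcard'
    refine Set.Subset.antisymm (fun z hz => ?_) (Set.insert_subset ?_ hrange)
    · rcases naryTree_adj_iff.1 hz with ⟨i, hi⟩ | ⟨i, hi⟩
      · refine Or.inl (Subtype.ext ?_)
        rw [hp, hi]; simp
      · exact Or.inr ⟨i, Subtype.ext hi.symm⟩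
    · refine naryTree_adj_iff.2 (Or.inl ⟨x.1.getLast hne, ?_⟩)
      rw [hp, List.dropLast_append_getLast]

namespace IsEdgeIso

variable {S S' : X.Component} {g : descendants S ≃ descendants S'}

theorem symm (hg : IsEdgeIso g) : IsEdgeIso g.symm := fun x y => by
  have h := hg (g.symm x) (g.symm y)
  simp only [Equiv.apply_symm_apply] at h
  exact ⟨h.1.symm, h.2.symm⟩

theorem length_eq_level_iff (hg : IsEdgeIso g) (x : descendants S) :
    x.1.length = level S ↔ (g x).1.length = level S' := by
  have h1 : verticalNeighbors (g x) = g '' verticalNeighbors x := by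
    ext z
    constructor
    · intro hz
      refine ⟨g.symm z, ?_, by simp⟩
      have := (hg x (g.symm z)).1
      rw [Equiv.apply_symm_apply] at this
      exact this.2 hz
    · rintro ⟨z, hz, rfl⟩
      exact (hg x z).1.1 hz
  have h2 := congrArg Set.ncard h1
  rw [Set.ncard_image_of_injective _ g.injective, ncard_verticalNeighbors,
    ncard_verticalNeighbors] at h2
  split_ifs at h2 <;> omega

/-- The image of a child is a vertical neighbour of `g x`. It cannot be the predecessor: on the top
level there is none, and below it the predecessor of `g x` is already the image of the predecessor
of `x`, by induction. -/
theorem exists_append (hg : IsEdgeIso g) (x : descendants S) (i : Fin N) :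
    ∃ j, (g ⟨x.1 ++ [i], append_mem_descendants x.2 _⟩).1 = (g x).1 ++ [j] := by
  obtain ⟨n, hn⟩ : ∃ n, n = x.1.length := ⟨_, rfl⟩
  induction n generalizing x i with
  | zero =>
    rcases naryTree_adj_iff.1 ((hg x ⟨x.1 ++ [i], append_mem_descendants x.2 _⟩).1.1
      (naryTree_adj_append _ _)) with ⟨j, hj⟩ | h
    · have h0 := level_le_of_mem_descendants x.2
      have h1 := (hg.length_eq_level_iff x).1 (by omega)
      have h2 := level_le_of_mem_descendants
        (g ⟨x.1 ++ [i], append_mem_descendants x.2 _⟩).2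
      rw [hj] at h1
      simp at h1; omega
    · exact h
  | succ n ih =>
    rcases naryTree_adj_iff.1 ((hg x ⟨x.1 ++ [i], append_mem_descendants x.2 _⟩).1.1
      (naryTree_adj_append _ _)) with ⟨j, hj⟩ | h
    · by_cases hx : x.1.length = level S
      · have h1 := (hg.length_eq_level_iff x).1 hx
        have h2 := level_le_of_mem_descendants
          (g ⟨x.1 ++ [i], append_mem_descendants x.2 _⟩).2
        rw [hj] at h1
        simp at h1; omega
      · have h3 := level_le_of_mem_descendants x.2
        have hne : x.1 ≠ [] := by intro h0; rw [h0] at hn; simp at hn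
        let p : descendants S := ⟨x.1.take n, take_mem_descendants x.2 (by omega)⟩
        have hp : p.1 ++ [x.1.getLast hne] = x.1 := by
          have : p.1 = x.1.dropLast := by
            rw [List.dropLast_eq_take, ← hn]; rfl
          rw [this, List.dropLast_append_getLast]
        obtain ⟨k, hk⟩ := ih p (x.1.getLast hne) (by simp [p]; omega)
        have hpx : (⟨p.1 ++ [x.1.getLast hne], append_mem_descendants p.2 _⟩ : descendants S) = x :=
          Subtype.ext hp
        rw [hpx, hj] at hk
        have h4 := g.injective (Subtype.ext (List.append_inj_left' hk rfl))
        have h5 := congrArg (fun z : descendants S => z.1.length) h4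
        simp [p] at h5
        omega
    · exact h

theorem prefix_append (hg : IsEdgeIso g) (x : descendants S) (w : List (Fin N)) :
    (g x).1 <+: (g ⟨x.1 ++ w, append_mem_descendants x.2 _⟩).1 := by
  induction w using List.reverseRecOn with
  | nil => simp
  | append_singleton w i ih =>
    obtain ⟨j, hj⟩ := hg.exists_append ⟨x.1 ++ w, append_mem_descendants x.2 _⟩ i
    simp only [List.append_assoc] at hj
    rw [hj]
    exact ih.trans (List.prefix_append _ _)

theorem comp_eq (hg : IsEdgeIso g) (x y : descendants S) (h : X.comp x.1 = X.comp y.1) :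
    X.comp (g x).1 = X.comp (g y).1 := by
  have key : ∀ (x y : List (Fin N)) (_ : X.horizontal.Walk x y) (hx : x ∈ descendants S)
      (hy : y ∈ descendants S), X.comp (g ⟨x, hx⟩).1 = X.comp (g ⟨y, hy⟩).1 := by
    intro x y p hx hy
    induction p with
    | nil => rfl
    | cons hadj p ih =>
    have hc := SimpleGraph.ConnectedComponent.connectedComponentMk_eq_of_adj hadj
    have hm := mem_descendants_of_comp_eq hx hc
    exact (SimpleGraph.ConnectedComponent.connectedComponentMk_eq_of_adj
      ((hg ⟨_, hx⟩ ⟨_, hm⟩).2.1 hadj)).trans (ih hm hy)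
  obtain ⟨p⟩ := SimpleGraph.ConnectedComponent.exact h
  exact key x.1 y.1 p x.2 y.2

theorem descendants_subset (r : descendants S) : descendants (X.comp r.1) ⊆ descendants S := by
  rintro z ⟨y, hy, w, rfl⟩
  exact append_mem_descendants (mem_descendants_of_comp_eq r.2 (mem_supp.1 hy).symm) w

theorem map_mem (hg : IsEdgeIso g) (r z : descendants S) (hz : z.1 ∈ descendants (X.comp r.1)) :
    (g z).1 ∈ descendants (X.comp (g r).1) := by
  obtain ⟨z, hz'⟩ := z
  obtain ⟨y, hy, w, rfl⟩ := hz
  have hyS := mem_descendants_of_comp_eq r.2 (mem_supp.1 hy).symm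
  exact ⟨(g ⟨y, hyS⟩).1, hg.comp_eq ⟨y, hyS⟩ r hy, hg.prefix_append ⟨y, hyS⟩ w⟩

/-- The isomorphism restricts to the descendants of `r`'s component, since both `g` and its inverse
respect prefixes and components. -/
theorem componentEquiv (hg : IsEdgeIso g) (r : descendants S) :
    ComponentEquiv (X.comp r.1) (X.comp (g r).1) := by
  have hr : g.symm (g r) = r := g.symm_apply_apply r
  have hinv : ∀ z : descendants S', z.1 ∈ descendants (X.comp (g r).1) →
      (g.symm z).1 ∈ descendants (X.comp r.1) := fun z hz => by
    have := hg.symm.map_mem (g r) z hz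
    rwa [hr] at this
  refine ⟨⟨fun z => ⟨(g ⟨z.1, descendants_subset r z.2⟩).1, hg.map_mem r _ z.2⟩,
    fun z => ⟨(g.symm ⟨z.1, descendants_subset (g r) z.2⟩).1, hinv _ z.2⟩,
    fun z => ?_, fun z => ?_⟩, fun x y => hg ⟨x.1, descendants_subset r x.2⟩ ⟨y.1, descendants_subset r y.2⟩⟩
  · simp
  · simp

end IsEdgeIso

theorem ncard_supp_eq_of_componentEquiv {S S' : X.Component} (h : ComponentEquiv S S') :
    S.supp.ncard = S'.supp.ncard := by
  obtain ⟨g, hg⟩ := h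
  have hg : IsEdgeIso g := hg
  refine Set.ncard_congr (fun x hx => (g ⟨x, supp_subset_descendants S hx⟩).1) ?_ ?_ ?_
  · intro x hx
    exact (mem_supp_iff_length (g _).2).2 ((hg.length_eq_level_iff _).1
      ((mem_supp_iff_length (supp_subset_descendants S hx)).1 hx))
  · intro x y hx hy hxy
    simpa using g.injective (Subtype.ext hxy)
  · intro y hy
    refine ⟨(g.symm ⟨y, supp_subset_descendants S' hy⟩).1, ?_, by simp⟩
    exact (mem_supp_iff_length (g.symm _).2).2 ((hg.symm.length_eq_level_iff _).1
      ((mem_supp_iff_length (supp_subset_descendants S' hy)).1 hy))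

/-- Entries of the incidence matrix are counted at a chosen representative of a class; this
transfers offspring from the representative to any other member. -/
theorem exists_offspring_of_componentEquiv {S S' R' : X.Component} (h : ComponentEquiv S S')
    (hR' : R' ∈ offspring S') : ∃ R ∈ offspring S, ComponentEquiv R R' := by
  obtain ⟨g, hg⟩ := h
  have hg : IsEdgeIso g := hg
  obtain ⟨x, hx, i, rfl⟩ := hR'
  have hxd := supp_subset_descendants S' hx
  obtain ⟨j, hj⟩ := hg.symm.exists_append ⟨x, hxd⟩ i
  refine ⟨X.comp (g.symm ⟨x ++ [i], append_mem_descendants hxd _⟩).1,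
    ⟨(g.symm ⟨x, hxd⟩).1, ?_, j, congrArg X.comp hj⟩, ?_⟩
  · exact (mem_supp_iff_length (g.symm _).2).2 ((hg.symm.length_eq_level_iff _).1
      ((mem_supp_iff_length hxd).1 hx))
  · have := hg.componentEquiv (g.symm ⟨x ++ [i], append_mem_descendants hxd _⟩)
    rwa [Equiv.apply_symm_apply] at this

/-- In a simple augmented tree the horizontal components have bounded size. -/
theorem exists_ncard_supp_le (X : AugmentedTree N) [h : X.IsSimple] :
    ∃ M, ∀ S : X.Component, S.supp.ncard ≤ M := by
  have := h.finite
  obtain ⟨M, hM⟩ := (Set.finite_range fun c : X.ComponentClass => c.out.supp.ncard).bddAbove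
  refine ⟨M, fun S => ?_⟩
  have h1 : ComponentEquiv (Quotient.out (Quotient.mk (componentSetoid X) S)) S :=
    Quotient.mk_out S
  rw [← ncard_supp_eq_of_componentEquiv h1]
  exact hM ⟨_, rfl⟩

end AugmentedTree

/-! ### Splitting weighted multisets into equal parts -/

section Partition

theorem exists_sum_mul_eq_gcd {ι : Type*} (s : Finset ι) (u : ι → ℕ) :
    ∃ z : ι → ℤ, ∑ j ∈ s, z j * u j = (s.gcd u : ℕ) := by
  classical
  induction s using Finset.induction_on with
  | empty => exact ⟨0, by simp⟩
  | insert i s hi ih =>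
    obtain ⟨z, hz⟩ := ih
    refine ⟨fun j => if j = i then Nat.gcdA (u i) (s.gcd u) else Nat.gcdB (u i) (s.gcd u) * z j, ?_⟩
    rw [Finset.sum_insert hi, Finset.gcd_insert, gcd_eq_nat_gcd, Nat.gcd_eq_gcd_ab,
      ← hz, Finset.sum_mul]
    simp only [if_true]
    rw [mul_comm]
    congr 1
    refine Finset.sum_congr rfl fun j hj => ?_
    rw [if_neg (fun h : j = i => hi (h ▸ hj))]
    ring

/-- A multiset that contains `c j` elements of size `u j`, each `c j` large, and has total size
`r * W` can be partitioned into `r` parts of size `W`, if the sizes have no common divisor. -/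
theorem exists_partition {ι : Type*} [Fintype ι] (u : ι → ℕ) (z : ι → ℤ)
    (hz : ∑ j, z j * u j = 1) (c : ι → ℕ) {r W : ℕ} (hr : 0 < r)
    (hsum : ∑ j, c j * u j = r * W)
    (hc : ∀ j, r * (r * (∑ i, u i) * (z j).natAbs) ≤ c j) :
    ∃ b : ℕ → ι → ℕ, (∀ j, ∑ s ∈ Finset.range r, b s j = c j) ∧
      ∀ s < r, ∑ j, b s j * u j = W := by
  obtain ⟨q, rfl⟩ := Nat.exists_eq_add_of_le' hr
  set r := q + 1 with hrdef
  set E := ∑ i, u i with hE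
  -- Give each part `c j / r` elements of every kind. Each part then lacks the same weight `e`, and
  -- since `r * e` is the weight of the remainders, `0 ≤ e ≤ E`.
  set e : ℤ := W - ∑ j, ((c j / r : ℕ) : ℤ) * u j with he
  have hre : (r : ℤ) * e = ∑ j, ((c j % r : ℕ) : ℤ) * u j := by
    have h1 : (r : ℤ) * W = ∑ j, (c j : ℤ) * u j := by exact_mod_cast hsum.symm
    rw [he, mul_sub, h1, Finset.mul_sum, ← Finset.sum_sub_distrib]
    refine Finset.sum_congr rfl fun j _ => ?_
    have h2 : (c j : ℤ) = r * (c j / r : ℕ) + (c j % r : ℕ) := by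
      exact_mod_cast (Nat.div_add_mod (c j) r).symm
    rw [h2]
    push_cast
    ring
  have hr0 : (0 : ℤ) < r := by exact_mod_cast hr
  have he0 : 0 ≤ e := by
    have : 0 ≤ (r : ℤ) * e := by rw [hre]; positivity
    exact nonneg_of_mul_nonneg_right this hr0
  have heE : e ≤ E := by
    have : (r : ℤ) * e ≤ r * E := by
      rw [hre, hE]
      push_cast
      rw [Finset.mul_sum]
      refine Finset.sum_le_sum fun j _ => ?_
      have : ((c j % r : ℕ) : ℤ) ≤ r := by exact_mod_cast (Nat.mod_lt _ hr).le
      exact mul_le_mul_of_nonneg_right this (by positivity)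
    exact le_of_mul_le_mul_left this hr0
  have hez : ∀ j, |e * z j| ≤ E * (z j).natAbs := fun j => by
    rw [abs_mul, abs_of_nonneg he0, Int.natCast_natAbs]
    exact mul_le_mul_of_nonneg_right heE (abs_nonneg _)
  have hdiv : ∀ j, (r : ℤ) * (E * (z j).natAbs) ≤ (c j / r : ℕ) := fun j => by
    have : r * E * (z j).natAbs ≤ c j / r := by
      rw [Nat.le_div_iff_mul_le hr, mul_comm]; exact hc j
    rw [← mul_assoc]
    exact_mod_cast this
  -- The deficit is repaired by `e` times the Bézout relation. The first `q = r - 1` parts receive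
  -- `t`, the last one whatever is left; the lower bound on `c j` keeps both nonnegative.
  set t : ι → ℤ := fun j => (c j / r : ℕ) + e * z j with ht
  have ht0 : ∀ j, 0 ≤ t j := fun j => by
    have h1 := (abs_le.1 (hez j)).1
    have h2 := hdiv j
    have h3 : (0 : ℤ) ≤ E * (z j).natAbs := by positivity
    have h4 : (r : ℤ) = q + 1 := by rw [hrdef]; push_cast; rfl
    rw [h4] at h2
    simp only [ht]
    nlinarith [mul_nonneg (Int.natCast_nonneg q) h3]
  have ht1 : ∀ j, 0 ≤ (c j : ℤ) - q * t j := fun j => by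
    have h1 := (abs_le.1 (hez j)).2
    have h2 := hdiv j
    have h3 : (0 : ℤ) ≤ E * (z j).natAbs := by positivity
    have h4 : (r : ℤ) = q + 1 := by rw [hrdef]; push_cast; rfl
    have h5 : (r : ℤ) * (c j / r : ℕ) ≤ c j := by exact_mod_cast Nat.mul_div_le (c j) r
    rw [h4] at h2 h5
    simp only [ht]
    nlinarith [mul_le_mul_of_nonneg_left h1 (Int.natCast_nonneg q)]
  have htW : ∑ j, t j * u j = W := by
    simp only [ht, add_mul, Finset.sum_add_distrib, mul_assoc, ← Finset.mul_sum, hz, he]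
    ring
  have hcW : ∑ j, (c j : ℤ) * u j = (q + 1) * W := by
    have : (∑ j, (c j : ℤ) * u j) = (r : ℤ) * W := by exact_mod_cast hsum
    rw [this, hrdef]; push_cast; rfl
  obtain ⟨b, hbt, hbq⟩ : ∃ b : ℕ → ι → ℕ, (∀ s < q, ∀ j, (b s j : ℤ) = t j) ∧
      ∀ j, (b q j : ℤ) = c j - q * t j :=
    ⟨fun s j => if s < q then (t j).toNat else ((c j : ℤ) - q * t j).toNat,
      fun s hs j => by simp only [if_pos hs, Int.toNat_of_nonneg (ht0 j)],
      fun j => by simp only [if_neg (lt_irrefl q), Int.toNat_of_nonneg (ht1 j)]⟩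
  refine ⟨b, fun j => ?_, fun s hs => ?_⟩
  · rw [hrdef, Finset.sum_range_succ]
    zify
    rw [hbq, Finset.sum_congr rfl (fun s hs => hbt s (Finset.mem_range.1 hs) j)]
    simp
  · zify
    rcases Nat.lt_succ_iff_lt_or_eq.1 hs with hsq | rfl
    · simp only [hbt s hsq, htW]
    · simp only [hbq, sub_mul, Finset.sum_sub_distrib, hcW, mul_assoc, ← Finset.mul_sum, htW]
      ring

theorem exists_fibers {α : Type*} [DecidableEq α] (C : Finset α) (b : ℕ → ℕ) (r : ℕ)
    (h : ∑ s ∈ Finset.range r, b s = C.card) :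
    ∃ f : α → ℕ, (∀ x ∈ C, f x < r) ∧ ∀ s < r, (C.filter (f · = s)).card = b s := by
  induction r generalizing C with
  | zero =>
    have : C = ∅ := by simpa using h.symm
    exact ⟨0, by simp [this], by simp⟩
  | succ r ih =>
    rw [Finset.sum_range_succ] at h
    obtain ⟨D, hDC, hD⟩ := Finset.exists_subset_card_eq (s := C) (n := b r) (by omega)
    obtain ⟨f, hf1, hf2⟩ := ih (C \ D) (by rw [Finset.card_sdiff_of_subset hDC]; omega)
    refine ⟨fun x => if x ∈ D then r else f x, fun x hx => ?_, fun s hs => ?_⟩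
    · by_cases hxD : x ∈ D
      · simp [hxD]
      · simp only [if_neg hxD]
        exact (hf1 x (Finset.mem_sdiff.2 ⟨hx, hxD⟩)).trans (Nat.lt_succ_self r)
    · rcases Nat.lt_succ_iff_lt_or_eq.1 hs with hs' | rfl
      · rw [← hf2 s hs']
        congr 1
        ext x
        by_cases hxD : x ∈ D
        · simp [hxD, hs'.ne']
        · simp [hxD]
      · rw [← hD]
        congr 1
        ext x
        by_cases hxD : x ∈ D
        · simp [hxD, hDC hxD]
        · simp only [Finset.mem_filter, hxD, iff_false, not_and]
          exact fun hx => (hf1 x (Finset.mem_sdiff.2 ⟨hx, hxD⟩)).ne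

/-- If each of finitely many kinds of objects, whose weights have no common divisor, occurs often
in `C`, then `C` can be partitioned into `r` parts of the same weight. -/
theorem exists_assignment {α ι : Type*} [DecidableEq α] [Fintype ι] [DecidableEq ι] (C : Finset α)
    (cl : α → ι) (v : ι → ℕ) (z : ι → ℤ) (hz : ∑ j, z j * v j = 1) {r W : ℕ} (hr : 0 < r)
    (hsum : ∑ x ∈ C, v (cl x) = r * W)
    (hC : ∀ j, r * (r * (∑ i, v i) * (z j).natAbs) ≤ (C.filter (cl · = j)).card) :
    ∃ f : α → ℕ, (∀ x ∈ C, f x < r) ∧ ∀ s < r, ∑ x ∈ C with f x = s, v (cl x) = W := by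
  obtain ⟨b, hb1, hb2⟩ := exists_partition v z hz (fun j => (C.filter (cl · = j)).card) hr
    (by
      rw [← hsum, ← Finset.sum_fiberwise_of_maps_to (g := cl) (t := Finset.univ) (by simp)]
      refine Finset.sum_congr rfl fun j _ => ?_
      rw [Finset.sum_congr rfl (fun x hx => by rw [(Finset.mem_filter.1 hx).2]),
        Finset.sum_const, smul_eq_mul]) hC
  -- The partition prescribes how many elements of each kind go to each part; each kind is then
  -- distributed separately.
  choose f hf1 hf2 using fun j => exists_fibers (C.filter (cl · = j)) (b · j) r (hb1 j)
  refine ⟨fun x => f (cl x) x, fun x hx => hf1 _ x (by simp [hx]), fun s hs => ?_⟩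
  rw [← hb2 s hs, ← Finset.sum_fiberwise_of_maps_to (g := cl) (t := Finset.univ) (by simp)]
  refine Finset.sum_congr rfl fun j _ => ?_
  rw [Finset.sum_congr rfl (fun x hx => by rw [(Finset.mem_filter.1 hx).2]),
    Finset.sum_const, smul_eq_mul, ← hf2 j s hs]
  congr 2
  ext x
  simp only [Finset.mem_filter]
  constructor
  · rintro ⟨⟨h1, h2⟩, rfl⟩; exact ⟨⟨h1, rfl⟩, h2⟩
  · rintro ⟨⟨h1, rfl⟩, h2⟩; exact ⟨⟨h1, h2⟩, rfl⟩

end Partition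

/-! ### Counting the components below a component -/

namespace AugmentedTree

variable {N : ℕ} {X : AugmentedTree N}

theorem finite_components_of_level (X : AugmentedTree N) (n : ℕ) :
    {R : X.Component | level R = n}.Finite := by
  refine ((List.finite_length_eq (Fin N) n).image X.comp).subset fun R hR => ?_
  obtain ⟨x, rfl⟩ := exists_comp R
  exact ⟨x, hR, rfl⟩

/-- The components of level `level S + k` below `S`. -/
noncomputable def children (k : ℕ) (S : X.Component) : Finset X.Component :=
  ((finite_components_of_level X (level S + k)).inter_of_left {R | trunc (level S) R = S}).toFinset

theorem mem_children {k : ℕ} {S R : X.Component} :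
    R ∈ children k S ↔ level R = level S + k ∧ trunc (level S) R = S := by
  simp [children]

theorem offspring_subset_children {S R : X.Component} (h : R ∈ offspring S) : R ∈ children 1 S := by
  obtain ⟨x, hx, i, rfl⟩ := h
  rw [mem_supp] at hx
  subst hx
  rw [mem_children]
  constructor
  · exact (level_comp (X := X) _).trans (by simp)
  · exact (trunc_comp (X := X) _ _).trans (by simp)

theorem children_trans {a b : ℕ} {S R Q : X.Component} (hR : R ∈ children a S)
    (hQ : Q ∈ children b R) : Q ∈ children (a + b) S := by
  rw [mem_children] at *
  refine ⟨by omega, ?_⟩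
  have h := trunc_trunc (level S) (level R) Q
  rw [hQ.2, hR.2, min_eq_left (by omega)] at h
  exact h.symm

theorem trunc_mem_children {a b : ℕ} {S Q : X.Component} (hQ : Q ∈ children (a + b) S) :
    trunc (level S + a) Q ∈ children a S := by
  rw [mem_children] at *
  rw [level_trunc, trunc_trunc]
  refine ⟨by omega, ?_⟩
  rw [min_eq_left (by omega)]
  exact hQ.2

/-- The number of vertices of a component. -/
noncomputable def size (S : X.Component) : ℕ := S.supp.ncard

theorem size_pos (S : X.Component) : 0 < size S :=
  (Set.ncard_pos (finite_supp S)).2 S.nonempty_supp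

theorem ncard_words (N k : ℕ) : {w : List (Fin N) | w.length = k}.ncard = N ^ k := by
  rw [← Nat.card_coe_set_eq]
  change Nat.card (List.Vector (Fin N) k) = _
  rw [Nat.card_eq_fintype_card, card_vector, Fintype.card_fin]

/-- The words of these components are exactly the words of `S` extended by `k` letters. -/
theorem sum_size_children (k : ℕ) (S : X.Component) :
    ∑ R ∈ children k S, size R = N ^ k * size S := by
  classical
  have hfin := List.finite_length_eq (Fin N) k
  set D : Set (List (Fin N)) :=
    (fun p : List (Fin N) × List (Fin N) => p.1 ++ p.2) '' (S.supp ×ˢ {w | w.length = k}) with hD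
  have hlen : ∀ x ∈ S.supp, x.length = level S := fun x hx => by
    rw [mem_supp] at hx; rw [← hx, level_comp]
  have hDfin : D.Finite := ((finite_supp S).prod hfin).image _
  have hcard : D.ncard = N ^ k * size S := by
    rw [hD, Set.InjOn.ncard_image, Set.ncard_prod, ncard_words, mul_comm]; rfl
    rintro ⟨x, w⟩ ⟨hx, hw⟩ ⟨y, v⟩ ⟨hy, hv⟩ h
    have := List.append_inj h ((hlen x hx).trans (hlen y hy).symm)
    exact Prod.ext this.1 this.2
  have hmem : ∀ x, x ∈ D ↔ X.comp x ∈ children k S := by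
    intro x
    rw [mem_children, level_comp, trunc_comp]
    constructor
    · rintro ⟨⟨y, w⟩, ⟨hy, hw⟩, rfl⟩
      have h1 := hlen y hy
      simp only [List.length_append]
      rw [List.take_append_of_le_length h1.ge, List.take_of_length_le h1.le, h1]
      exact ⟨by rw [hw], hy⟩
    · rintro ⟨h1, h2⟩
      refine ⟨(x.take (level S), x.drop (level S)), ⟨h2, ?_⟩, by simp⟩
      simp [h1]
  rw [← hcard, Set.ncard_eq_toFinset_card D hDfin,
    Finset.card_eq_sum_card_fiberwise (f := X.comp) (t := children k S)
      (fun x hx => (hmem x).1 (by simpa using hx))]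
  refine Finset.sum_congr rfl fun R hR => ?_
  rw [size, ← Set.ncard_coe_finset]
  congr 1
  ext x
  simp only [mem_supp, Finset.coe_filter, Set.Finite.mem_toFinset, Set.mem_ofPred_eq]
  constructor
  · intro h; exact ⟨(hmem x).2 (h ▸ hR), h⟩
  · exact fun h => h.2

theorem pow_le_card_children {M : ℕ} (hM : ∀ S : X.Component, size S ≤ M) (q : ℕ)
    (S : X.Component) : N ^ q ≤ (children q S).card * M := by
  calc N ^ q ≤ N ^ q * size S := Nat.le_mul_of_pos_right _ (size_pos S)
    _ = ∑ R ∈ children q S, size R := (sum_size_children q S).symm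
    _ ≤ ∑ R ∈ children q S, M := Finset.sum_le_sum fun R _ => hM R
    _ = _ := by simp

section Classes

variable (T : X.Component)

/-- The components below `T`, other than `T`. -/
def IsBelow (S : X.Component) : Prop := trunc (level T) S = T ∧ level T < level S

variable {T}

theorem IsBelow.of_mem_children {S R : X.Component} (hS : IsBelow T S) {k : ℕ} (hR : R ∈ children k S) :
    IsBelow T R := by
  have h := trunc_trunc (level T) (level S) R
  rw [mem_children] at hR
  rw [hR.2, hS.1, min_eq_left hS.2.le] at h
  exact ⟨h.symm, by have := hS.2; omega⟩

theorem isBelow_of_mem_children {R : X.Component} {k : ℕ} (hk : 1 ≤ k) (hR : R ∈ children k T) :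
    IsBelow T R := by
  rw [mem_children] at hR
  exact ⟨hR.2, by omega⟩

theorem isBelow_iff {S : X.Component} : IsBelow T S ↔ S ≠ T ∧ S.supp ⊆ descendants T := by
  rw [supp_subset_descendants_iff]
  constructor
  · rintro ⟨h1, h2⟩
    exact ⟨by rintro rfl; exact lt_irrefl _ h2, h1⟩
  · rintro ⟨h1, h2⟩
    refine ⟨h2, ?_⟩
    by_contra h3
    rw [trunc_of_level_le (not_lt.1 h3)] at h2
    exact h1 h2

/-- The class of a component below `T`. -/
def IsBelow.cls {S : X.Component} (hS : IsBelow T S) : DescendantClass T :=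
  ⟨Quotient.mk _ S, S, (isBelow_iff.1 hS).1, (isBelow_iff.1 hS).2, rfl⟩

/-- The common size of the components of a class. -/
noncomputable def classSize (c : DescendantClass T) : ℕ := size c.1.out

theorem componentEquiv_out (S : X.Component) :
    ComponentEquiv (Quotient.out (Quotient.mk (componentSetoid X) S)) S :=
  Quotient.mk_out S

theorem IsBelow.classSize_cls {S : X.Component} (hS : IsBelow T S) :
    classSize hS.cls = size S :=
  ncard_supp_eq_of_componentEquiv (componentEquiv_out S)

variable [X.IsSimple]

/-- A positive entry of the `n`-th power comes from a chain of `n` positive entries, and each of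
these is realised by an offspring of the actual component reached so far. -/
theorem exists_mem_children_of_pow_pos {n : ℕ} {S : X.Component} (hS : IsBelow T S)
    (c : DescendantClass T) (h : 0 < (incidenceMatrix T ^ n) hS.cls c) :
    ∃ R, ∃ hR : R ∈ children n S, (hS.of_mem_children hR).cls = c := by
  induction n generalizing S with
  | zero =>
    have hc : hS.cls = c := by
      by_contra hne
      rw [pow_zero, Matrix.one_apply_ne hne] at h
      exact lt_irrefl _ h
    exact ⟨S, by rw [mem_children]; exact ⟨rfl, trunc_of_level_le le_rfl⟩, hc⟩
  | succ n ih =>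
    rw [pow_succ', Matrix.mul_apply] at h
    obtain ⟨d, -, hd⟩ := Finset.exists_lt_of_sum_lt (s := Finset.univ)
      (f := fun _ : DescendantClass T => (0 : ℤ)) (by simpa using h)
    have h0 : 0 ≤ incidenceMatrix T hS.cls d := Int.natCast_nonneg _
    have h1 : 0 < incidenceMatrix T hS.cls d := lt_of_le_of_ne h0 fun h1 => by
      rw [← h1] at hd; simp at hd
    have h2 := (mul_pos_iff_of_pos_left h1).1 hd
    have h3 : {S' ∈ offspring hS.cls.1.out |
        (Quotient.mk _ S' : X.ComponentClass) = d.1}.Nonempty := by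
      by_contra hne
      rw [Set.not_nonempty_iff_eq_empty] at hne
      rw [incidenceMatrix, hne] at h1
      simp at h1
    obtain ⟨R', hR', hd'⟩ := h3
    obtain ⟨R, hR, hRR'⟩ := exists_offspring_of_componentEquiv
      ((componentSetoid X).symm (componentEquiv_out S)) hR'
    have hRc := offspring_subset_children hR
    have hcls : (hS.of_mem_children hRc).cls = d := Subtype.ext ((Quotient.sound hRR').trans hd')
    rw [← hcls] at h2
    obtain ⟨Q, hQ, hQc⟩ := ih (hS.of_mem_children hRc) h2
    refine ⟨Q, ?_, hQc⟩
    rw [add_comm]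
    exact children_trans hRc hQ

end Classes

end AugmentedTree

/-! ### Weights and their even distribution -/

namespace AugmentedTree

variable {N : ℕ} {X : AugmentedTree N} {T : X.Component} [X.IsSimple]

/-- The greatest common divisor of the sizes of the components below `T`. -/
noncomputable def gcdSize (T : X.Component) : ℕ := Finset.univ.gcd (classSize (T := T))

/-- The size of a component in units of the greatest common divisor. -/
noncomputable def weight (T S : X.Component) : ℕ := size S / gcdSize T

theorem IsBelow.gcdSize_dvd {S : X.Component} (hS : IsBelow T S) : gcdSize T ∣ size S := by
  rw [← hS.classSize_cls]
  exact Finset.gcd_dvd (Finset.mem_univ _)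

theorem IsBelow.gcdSize_pos {S : X.Component} (hS : IsBelow T S) : 0 < gcdSize T :=
  Nat.pos_of_dvd_of_pos hS.gcdSize_dvd (size_pos S)

theorem IsBelow.weight_mul {S : X.Component} (hS : IsBelow T S) :
    weight T S * gcdSize T = size S := Nat.div_mul_cancel hS.gcdSize_dvd

theorem IsBelow.weight_pos {S : X.Component} (hS : IsBelow T S) : 0 < weight T S :=
  Nat.div_pos (Nat.le_of_dvd (size_pos S) hS.gcdSize_dvd) hS.gcdSize_pos

theorem weight_le_size (T S : X.Component) : weight T S ≤ size S := Nat.div_le_self _ _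

theorem IsBelow.sum_weight_children {S : X.Component} (hS : IsBelow T S) (k : ℕ) :
    ∑ R ∈ children k S, weight T R = weight T S * N ^ k := by
  apply Nat.eq_of_mul_eq_mul_right hS.gcdSize_pos
  rw [Finset.sum_mul, Finset.sum_congr rfl fun R hR => (hS.of_mem_children hR).weight_mul,
    sum_size_children, mul_right_comm, hS.weight_mul, mul_comm]

open scoped Classical in
/-- If the incidence matrix is primitive, then at a suitable depth the components below each
component `S` can be distributed evenly among the units of weight of `S`. -/
theorem exists_even_assignment (hN : 1 ≤ N) (hA : (incidenceMatrix T).IsPrimitive) :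
    ∃ k, 1 ≤ k ∧ ∀ S, IsBelow T S → ∃ f : X.Component → ℕ,
      (∀ R ∈ children k S, f R < weight T S) ∧
      ∀ s < weight T S, ∑ R ∈ children k S with f R = s, weight T R = N ^ k := by
  obtain ⟨M, hM⟩ := exists_ncard_supp_le X
  replace hM : ∀ S : X.Component, size S ≤ M := hM
  obtain rfl | hN2 := hN.eq_or_lt
  -- For one letter each level has a single word, so all weights are 1 and the only unit takes
  -- everything.
  · refine ⟨1, le_rfl, fun S hS => ⟨fun _ => 0, fun R _ => hS.weight_pos, fun s hs => ?_⟩⟩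
    have hone : size S ≤ 1 := by
      rw [size, Set.ncard_le_one_iff (finite_supp S)]
      intro x y hx hy
      exact List.ext_getElem (length_eq_of_comp_eq (hx.trans hy.symm)) fun _ _ _ =>
        Subsingleton.elim _ _
    have hw : weight T S = 1 := le_antisymm ((weight_le_size T S).trans hone) hS.weight_pos
    obtain rfl : s = 0 := by omega
    simpa [hw] using hS.sum_weight_children 1
  · obtain ⟨n, hn, hpos⟩ := hA.exists_pos_pow
    obtain ⟨z, hz⟩ := exists_sum_mul_eq_gcd Finset.univ (classSize (T := T))
    set v : DescendantClass T → ℕ := fun c => classSize c / gcdSize T with hv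
    -- `K` dominates the multiplicity that `exists_assignment` demands, for all classes and all
    -- weights `r ≤ M` at once. The depth `q = M * K` ensures `N ^ q > M * K`, hence more than `K`
    -- components `q` levels below `S`.
    set K := M * (M * (∑ c, v c) * ∑ c, (z c).natAbs) with hK
    set q := M * K with hq
    refine ⟨q + n, by omega, fun S hS => ?_⟩
    let cl : X.Component → DescendantClass T := fun R =>
      -- The default class is never used, as all children of `S` are below `T`.
      if h : IsBelow T R then h.cls else hS.cls
    have hcl : ∀ R (h : IsBelow T R), cl R = h.cls := fun R h => dif_pos h
    have hvcl : ∀ R, IsBelow T R → v (cl R) = weight T R := fun R h => by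
      rw [hcl R h, hv, weight]
      simp only [h.classSize_cls]
    have hzv : ∑ c, z c * (v c : ℤ) = 1 := by
      have h1 : (gcdSize T : ℤ) ≠ 0 := by exact_mod_cast hS.gcdSize_pos.ne'
      apply mul_right_cancel₀ h1
      rw [Finset.sum_mul, one_mul]
      refine Eq.trans (Finset.sum_congr rfl fun c _ => ?_) hz
      rw [mul_assoc]
      congr 1
      exact_mod_cast Nat.div_mul_cancel (Finset.gcd_dvd (f := classSize) (Finset.mem_univ c))
    have hcard : ∀ c, K ≤ ((children (q + n) S).filter (cl · = c)).card := by
      intro c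
      have h1 : (children q S).card ≤ ((children (q + n) S).filter (cl · = c)).card := by
        -- Each component `q` levels below `S` has, `n` levels further down, a component of class
        -- `c`; truncation tells these apart.
        refine Finset.card_le_card_of_surjOn (trunc (level S + q)) fun R hR => ?_
        have hRb := hS.of_mem_children hR
        obtain ⟨Q, hQ, hQc⟩ := exists_mem_children_of_pow_pos hRb c (hpos _ _)
        refine ⟨Q, ?_, ?_⟩
        · simp only [Finset.coe_filter, Set.mem_ofPred_eq]
          exact ⟨children_trans hR hQ, (hcl Q (hRb.of_mem_children hQ)).trans hQc⟩
        · rw [← (mem_children.1 hR).1]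
          exact (mem_children.1 hQ).2
      have h2 := pow_le_card_children hM q S
      have h3 : q < N ^ q := Nat.lt_pow_self hN2
      have h4 : M * K < M * (children q S).card := by
        rw [mul_comm M (children q S).card]; exact h3.trans_le h2
      exact (Nat.lt_of_mul_lt_mul_left h4).le.trans h1
    obtain ⟨f, hf1, hf2⟩ := exists_assignment (children (q + n) S) cl v z hzv
      (r := weight T S) (W := N ^ (q + n)) hS.weight_pos
      (by
        rw [← hS.sum_weight_children]
        exact Finset.sum_congr rfl fun R hR => hvcl R (hS.of_mem_children hR))
      (fun c => by
        refine le_trans ?_ (hcard c)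
        have hwM : weight T S ≤ M := (weight_le_size T S).trans (hM S)
        have hzc : (z c).natAbs ≤ ∑ c, (z c).natAbs :=
          Finset.single_le_sum (f := fun c => (z c).natAbs) (fun _ _ => Nat.zero_le _)
            (Finset.mem_univ c)
        rw [hK]
        gcongr)
    refine ⟨f, hf1, fun s hs => ?_⟩
    rw [← hf2 s hs]
    exact Finset.sum_congr rfl fun R hR => (hvcl R (hS.of_mem_children (Finset.mem_filter.1 hR).1)).symm

end AugmentedTree

theorem exists_bijOn_of_ncard_eq {α β : Type*} [Nonempty β] {s : Set α} {t : Set β}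
    (hs : s.Finite) (ht : t.Finite) (h : s.ncard = t.ncard) : ∃ f : α → β, Set.BijOn f s t := by
  apply hs.exists_bijOn_of_encard_eq
  rw [← hs.cast_ncard_eq, ← ht.cast_ncard_eq, h]

/-! ### The block-reading machine -/

namespace AugmentedTree

variable {N : ℕ} {X : AugmentedTree N} {T : X.Component} [X.IsSimple]

/-- The pairs that consist of a component and one of its units of weight. -/
def units (T : X.Component) (C : Set X.Component) : Set (X.Component × ℕ) :=
  {p | p.1 ∈ C ∧ p.2 < weight T p.1}

theorem finite_units (C : Finset X.Component) : (units T C).Finite := by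
  have h : (C.sigma fun R => Finset.range (weight T R) : Set (Σ _ : X.Component, ℕ)).Finite :=
    Finset.finite_toSet _
  refine (h.image fun p => (p.1, p.2)).subset ?_
  rintro ⟨R, t⟩ ⟨h1, h2⟩
  exact ⟨⟨R, t⟩, by simpa using ⟨h1, h2⟩, rfl⟩

theorem ncard_units (C : Finset X.Component) : (units T C).ncard = ∑ R ∈ C, weight T R := by
  have h : units T C = ((C.sigma fun R => Finset.range (weight T R)).map
      (Equiv.sigmaEquivProd X.Component ℕ).toEmbedding : Set (X.Component × ℕ)) := by
    ext ⟨R, t⟩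
    simp [units]
  rw [h, Set.ncard_coe_finset, Finset.card_map, Finset.card_sigma]
  simp

/-- A transition function on the units of weight, which reads a block of `k` letters and passes to
a unit of a component `k` levels below; each such component is reached from a single unit. -/
structure IsStep (T : X.Component) (k : ℕ)
    (step : X.Component × ℕ → List (Fin N) → X.Component × ℕ) : Prop where
  mem : ∀ {S s v}, IsBelow T S → s < weight T S → v.length = k →
    (step (S, s) v).1 ∈ children k S
  lt : ∀ {S s v}, IsBelow T S → s < weight T S → v.length = k →
    (step (S, s) v).2 < weight T (step (S, s) v).1
  unit_inj : ∀ {S s s' v v'}, IsBelow T S → s < weight T S → s' < weight T S → v.length = k →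
    v'.length = k → (step (S, s) v).1 = (step (S, s') v').1 → s = s'
  word_inj : ∀ {S s v v'}, IsBelow T S → s < weight T S → v.length = k → v'.length = k →
    step (S, s) v = step (S, s) v' → v = v'
  surj : ∀ {S R t}, IsBelow T S → R ∈ children k S → t < weight T R →
    ∃ s v, s < weight T S ∧ v.length = k ∧ step (S, s) v = (R, t)

/-- The group assigned to a unit has weight `N ^ k`, as many units as there are words of length `k`;
any bijection serves as transition. Assigning whole components to the groups gives `unit_inj`. -/
theorem exists_isStep (hN : 1 ≤ N) (hA : (incidenceMatrix T).IsPrimitive) :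
    ∃ k, 1 ≤ k ∧ ∃ step, IsStep T k step := by
  classical
  have : Nonempty X.Component := ⟨T⟩
  obtain ⟨k, hk, h⟩ := exists_even_assignment hN hA
  have key : ∀ S, ∃ (f : X.Component → ℕ) (g : ℕ → List (Fin N) → X.Component × ℕ),
      IsBelow T S → (∀ R ∈ children k S, f R < weight T S) ∧ ∀ s < weight T S,
      Set.BijOn (g s) {v | v.length = k} (units T ((children k S).filter (f · = s))) := by
    intro S
    by_cases hS : IsBelow T S
    · obtain ⟨f, hf1, hf2⟩ := h S hS
      have : ∀ s, ∃ g : List (Fin N) → X.Component × ℕ, s < weight T S →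
          Set.BijOn g {v | v.length = k} (units T ((children k S).filter (f · = s))) := by
        intro s
        by_cases hs : s < weight T S
        · obtain ⟨g, hg⟩ := exists_bijOn_of_ncard_eq (List.finite_length_eq (Fin N) k)
            (finite_units (T := T) ((children k S).filter (f · = s)))
            (by rw [ncard_words, ncard_units, hf2 s hs])
          exact ⟨g, fun _ => hg⟩
        -- An arbitrary value, since `s` is not a unit of `S`.
        · exact ⟨fun _ => (T, 0), fun h => (hs h).elim⟩
      choose g hg using this
      exact ⟨f, g, fun _ => ⟨hf1, hg⟩⟩
    · exact ⟨0, fun _ _ => (T, 0), fun h => (hS h).elim⟩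
  choose f g hfg using key
  refine ⟨k, hk, fun p v => g p.1 p.2 v, ?_, ?_, ?_, ?_, ?_⟩
  · intro S s v hS hs hv
    have := ((hfg S hS).2 s hs).mapsTo hv
    exact (Finset.mem_filter.1 (Finset.mem_coe.1 this.1)).1
  · intro S s v hS hs hv
    exact (((hfg S hS).2 s hs).mapsTo hv).2
  · intro S s s' v v' hS hs hs' hv hv' heq
    have h1 := (Finset.mem_filter.1 (Finset.mem_coe.1 (((hfg S hS).2 s hs).mapsTo hv).1)).2
    have h2 := (Finset.mem_filter.1 (Finset.mem_coe.1 (((hfg S hS).2 s' hs').mapsTo hv').1)).2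
    rw [← h1, ← h2]
    exact congrArg _ heq
  · intro S s v v' hS hs hv hv' heq
    exact ((hfg S hS).2 s hs).injOn hv hv' heq
  · intro S R t hS hR ht
    have hs := (hfg S hS).1 R hR
    obtain ⟨v, hv, hvR⟩ := ((hfg S hS).2 _ hs).surjOn
      (show (R, t) ∈ units T ((children k S).filter (f S · = f S R)) from
        ⟨by simpa using hR, ht⟩)
    exact ⟨_, v, hs, hv, hvR⟩

/-- The state that is reached after `n` blocks of `k` letters. -/
def run {n₀ : ℕ} (start : Fin n₀ → X.Component × ℕ)
    (step : X.Component × ℕ → List (Fin N) → X.Component × ℕ) (k : ℕ) :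
    ℕ → Fin n₀ × List (Fin N) → X.Component × ℕ
  | 0, p => start p.1
  | n + 1, p => step (run start step k n p) ((p.2.drop (n * k)).take k)

section Run

variable {n₀ k : ℕ} {start : Fin n₀ → X.Component × ℕ}
  {step : X.Component × ℕ → List (Fin N) → X.Component × ℕ}

theorem length_block {w : List (Fin N)} {n : ℕ} (hw : (n + 1) * k ≤ w.length) :
    ((w.drop (n * k)).take k).length = k := by
  rw [add_mul] at hw
  simp; omega

omit [X.IsSimple] in
theorem run_congr {p p' : Fin n₀ × List (Fin N)} (h : p.1 = p'.1) {n : ℕ}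
    (hw : p.2.take (n * k) = p'.2.take (n * k)) :
    run start step k n p = run start step k n p' := by
  induction n with
  | zero => simp [run, h]
  | succ n ih =>
    have h1 := congrArg (List.take (n * k)) hw
    have h2 := congrArg (List.drop (n * k)) hw
    rw [List.take_take, List.take_take, min_eq_left (Nat.mul_le_mul_right k (Nat.le_succ n))] at h1
    rw [List.drop_take, List.drop_take, add_mul, one_mul, Nat.add_sub_cancel_left] at h2
    rw [run, run, ih h1, h2]

variable (hstep : IsStep T k step) (hstart : Set.BijOn start Set.univ (units T (children 1 T)))

include hstep hstart

theorem run_mem {n : ℕ} {p : Fin n₀ × List (Fin N)} (hp : n * k ≤ p.2.length) :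
    (run start step k n p).1 ∈ children (1 + n * k) T ∧
      (run start step k n p).2 < weight T (run start step k n p).1 := by
  induction n with
  | zero =>
    have := hstart.mapsTo (Set.mem_univ p.1)
    simpa [run, units] using this
  | succ n ih =>
    obtain ⟨h1, h2⟩ := ih ((Nat.mul_le_mul_right k (Nat.le_succ n)).trans hp)
    have hb := isBelow_of_mem_children (by omega) h1
    rw [run]
    refine ⟨?_, hstep.lt hb h2 (length_block hp)⟩
    have := children_trans h1 (hstep.mem hb h2 (length_block hp))
    rwa [add_assoc, ← Nat.succ_mul] at this

theorem run_isBelow {n : ℕ} {p : Fin n₀ × List (Fin N)} (hp : n * k ≤ p.2.length) :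
    IsBelow T (run start step k n p).1 :=
  isBelow_of_mem_children (by omega) (run_mem hstep hstart hp).1

theorem level_run {n : ℕ} {p : Fin n₀ × List (Fin N)} (hp : n * k ≤ p.2.length) :
    level (run start step k n p).1 = level T + 1 + n * k := by
  rw [(mem_children.1 (run_mem hstep hstart hp).1).1, add_assoc]

theorem trunc_run {j n : ℕ} (hjn : j ≤ n) {p : Fin n₀ × List (Fin N)} (hp : n * k ≤ p.2.length) :
    trunc (level T + 1 + j * k) (run start step k n p).1 = (run start step k j p).1 := by
  induction n, hjn using Nat.le_induction with
  | base => exact trunc_of_level_le (level_run hstep hstart hp).le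
  | succ n hjn ih =>
    have hp' := (Nat.mul_le_mul_right k (Nat.le_succ n)).trans hp
    have h1 := (mem_children.1 (hstep.mem (run_isBelow hstep hstart hp')
      (run_mem hstep hstart hp').2 (length_block hp))).2
    rw [level_run hstep hstart hp'] at h1
    rw [← ih hp', run, ← h1, trunc_trunc, min_eq_left]
    have := Nat.mul_le_mul_right k hjn
    omega

/-- Backwards determinism: truncation recovers the previous component, `unit_inj` its unit, and
`word_inj` the last block. -/
theorem run_inj {n : ℕ} {p p' : Fin n₀ × List (Fin N)} (hp : n * k ≤ p.2.length)
    (hp' : n * k ≤ p'.2.length) (h : run start step k n p = run start step k n p') :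
    p.1 = p'.1 ∧ p.2.take (n * k) = p'.2.take (n * k) := by
  induction n with
  | zero => exact ⟨hstart.injOn (Set.mem_univ _) (Set.mem_univ _) h, by simp⟩
  | succ n ih =>
    have hn := Nat.mul_le_mul_right k (Nat.le_succ n)
    have h1 : (run start step k n p).1 = (run start step k n p').1 := by
      rw [← trunc_run hstep hstart (Nat.le_succ n) hp, h,
        trunc_run hstep hstart (Nat.le_succ n) hp']
    have hb := run_isBelow hstep hstart (hn.trans hp)
    have hlt := (run_mem hstep hstart (hn.trans hp)).2
    have hlt' := (run_mem hstep hstart (hn.trans hp')).2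
    rw [← h1] at hlt'
    have e' : run start step k n p' = ((run start step k n p).1, (run start step k n p').2) := by
      rw [h1]
    have h2 : (run start step k n p).2 = (run start step k n p').2 := by
      refine hstep.unit_inj hb hlt hlt' (length_block hp) (length_block hp') ?_
      rw [← e']
      exact congrArg Prod.fst h
    have h3 := Prod.ext h1 h2
    obtain ⟨i1, i2⟩ := ih (hn.trans hp) (hn.trans hp') h3
    refine ⟨i1, ?_⟩
    have h4 : (p.2.drop (n * k)).take k = (p'.2.drop (n * k)).take k := by
      refine hstep.word_inj hb hlt (length_block hp) (length_block hp') ?_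
      rw [run, run, ← h3] at h
      exact h
    rw [Nat.succ_mul, List.take_add, List.take_add, i2, h4]

/-- The component alone does not reveal the current unit, but it belongs to the group of one unit of
the previous component. Hence the previous state is known, and only the last block is lost. -/
theorem run_fst_inj {n : ℕ} {p p' : Fin n₀ × List (Fin N)} (hp : (n + 1) * k ≤ p.2.length)
    (hp' : (n + 1) * k ≤ p'.2.length)
    (h : (run start step k (n + 1) p).1 = (run start step k (n + 1) p').1) :
    p.1 = p'.1 ∧ p.2.take (n * k) = p'.2.take (n * k) := by
  have hn := Nat.mul_le_mul_right k (Nat.le_succ n)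
  have h1 : (run start step k n p).1 = (run start step k n p').1 := by
    rw [← trunc_run hstep hstart (Nat.le_succ n) hp, h,
      trunc_run hstep hstart (Nat.le_succ n) hp']
  have hlt' := (run_mem hstep hstart (hn.trans hp')).2
  rw [← h1] at hlt'
  have e' : run start step k n p' = ((run start step k n p).1, (run start step k n p').2) := by
    rw [h1]
  have h2 : (run start step k n p).2 = (run start step k n p').2 := by
    refine hstep.unit_inj (run_isBelow hstep hstart (hn.trans hp))
      (run_mem hstep hstart (hn.trans hp)).2 hlt' (length_block hp) (length_block hp') ?_
    rw [← e']
    exact h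
  exact run_inj hstep hstart (hn.trans hp) (hn.trans hp') (Prod.ext h1 h2)

/-- Runs the machine backwards: `R` lies in the group of some unit of its ancestor `k` levels
higher, and that unit is reached by induction. -/
theorem exists_run_eq {n : ℕ} {R : X.Component} {t : ℕ} (hR : R ∈ children (1 + n * k) T)
    (ht : t < weight T R) :
    ∃ p : Fin n₀ × List (Fin N), p.2.length = n * k ∧ run start step k n p = (R, t) := by
  induction n generalizing R t with
  | zero =>
    obtain ⟨i, -, hi⟩ := hstart.surjOn (show (R, t) ∈ units T (children 1 T) from
      ⟨by simpa using hR, ht⟩)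
    exact ⟨(i, []), by simp, hi⟩
  | succ n ih =>
    rw [Nat.succ_mul, ← add_assoc] at hR
    have hS := trunc_mem_children hR
    have hSb := isBelow_of_mem_children (by omega) hS
    have hRS : R ∈ children k (trunc (level T + (1 + n * k)) R) := by
      rw [mem_children] at hR hS ⊢
      rw [hS.1]
      exact ⟨by omega, rfl⟩
    obtain ⟨s, v, hs, hv, hvR⟩ := hstep.surj hSb hRS ht
    obtain ⟨⟨i, w⟩, hw, hi⟩ := ih hS hs
    simp only at hw
    refine ⟨(i, w ++ v), by simp [hw, hv, Nat.succ_mul], ?_⟩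
    have h1 : run start step k n (i, w ++ v) = run start step k n (i, w) :=
      run_congr (p := (i, w ++ v)) (p' := (i, w)) rfl
        (by simp only; rw [← hw, List.take_left, List.take_length])
    rw [run, h1, hi, ← hvR]
    simp only
    rw [← hw, List.drop_left, List.take_of_length_le hv.le]

end Run

end AugmentedTree

/-! ### Matching vertices with words -/

namespace AugmentedTree

variable {N : ℕ} {X : AugmentedTree N} {T : X.Component}

/-- The words of `T`, among its descendants. -/
def tops (T : X.Component) : Set (descendants T) := {x | x.1 ∈ T.supp}

theorem lt_length_of_notMem_tops (x : ((tops T)ᶜ : Set (descendants T))) :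
    level T < x.1.1.length := by
  refine lt_of_le_of_ne (level_le_of_mem_descendants x.1.2) fun h => x.2 ?_
  exact (mem_supp_iff_length x.1.2).2 h.symm

theorem notMem_tops {x : descendants T} (h : level T < x.1.length) : x ∉ tops T := fun hx =>
  h.ne' ((mem_supp_iff_length x.2).1 hx)

theorem comp_take_mem_children {x : List (Fin N)} (hx : x ∈ descendants T) {m : ℕ}
    (hm : level T + m ≤ x.length) : X.comp (x.take (level T + m)) ∈ children m T := by
  rw [mem_children, level_comp, trunc_comp, List.take_take, min_eq_left (by omega)]
  exact ⟨by simp; omega, mem_descendants_iff.1 hx⟩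

theorem mem_descendants_of_comp_isBelow {x : List (Fin N)} (h : IsBelow T (X.comp x)) :
    x ∈ descendants T :=
  mem_descendants_iff.2 h.1

theorem words_ext_of_subsingleton {x y : List (Fin 1)} (h : x.length = y.length) : x = y :=
  List.ext_getElem h fun _ _ _ => Subsingleton.elim _ _

variable [X.IsSimple]

/-- The vertices of each component can be encoded by words of a fixed length. -/
theorem exists_code (hN : 1 ≤ N) (X : AugmentedTree N) [X.IsSimple] :
    ∃ (K : ℕ) (code : List (Fin N) → List (Fin N)), (∀ x, (code x).length = K) ∧
      ∀ x y, X.comp x = X.comp y → code x = code y → x = y := by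
  obtain rfl | hN2 := hN.eq_or_lt
  · exact ⟨0, fun _ => [], fun _ => rfl, fun x y h _ =>
      words_ext_of_subsingleton (length_eq_of_comp_eq h)⟩
  · obtain ⟨M, hM⟩ := exists_ncard_supp_le X
    have key : ∀ S : X.Component, ∃ c : List (Fin N) → List (Fin N),
        S.supp ⊆ c ⁻¹' {w | w.length = M} ∧ Set.InjOn c S.supp := fun S => by
      refine (finite_supp S).exists_injOn_of_encard_le ?_
      rw [← (finite_supp S).cast_ncard_eq, ← (List.finite_length_eq (Fin N) M).cast_ncard_eq,
        ncard_words]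
      -- There are `N ^ M > M` words of length `M`, enough for any component.
      exact_mod_cast (hM S).trans (Nat.lt_pow_self hN2).le
    choose c hc1 hc2 using key
    refine ⟨M, fun x => c (X.comp x) x, fun x => hc1 _ (rfl : X.comp x = X.comp x), ?_⟩
    intro x y hxy h
    simp only [hxy] at h
    exact hc2 _ hxy rfl h

/-- The relation between the words below `T` and the words read by the transition function. -/
def Corresponds {n₀ : ℕ} (T : X.Component) (start : Fin n₀ → X.Component × ℕ)
    (step : X.Component × ℕ → List (Fin N) → X.Component × ℕ) (k K : ℕ)
    (x : ((tops T)ᶜ : Set (descendants T))) (p : Fin n₀ × List (Fin N)) : Prop :=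
  x.1.1.length ≤ level T + 1 + p.2.length + K ∧ level T + 1 + p.2.length ≤ x.1.1.length + K ∧
    ∀ j, level T + 1 + j * k ≤ x.1.1.length → j * k ≤ p.2.length →
      X.comp (x.1.1.take (level T + 1 + j * k)) = (run start step k j p).1

section Correspondence

variable {n₀ k K : ℕ} {start : Fin n₀ → X.Component × ℕ}
  {step : X.Component × ℕ → List (Fin N) → X.Component × ℕ}

/-- Equal prefixes lead to equal states, and equal components to prefixes equal up to one block.
Rounding to multiples of `k` and the length discrepancy `K` give the constant, which is not optimal.
-/
theorem Corresponds.abs_sub_le (hk : 1 ≤ k) (hstep : IsStep T k step)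
    (hstart : Set.BijOn start Set.univ (units T (children 1 T)))
    {x y : ((tops T)ᶜ : Set (descendants T))} {p q : Fin n₀ × List (Fin N)}
    (hx : Corresponds T start step k K x p) (hy : Corresponds T start step k K y q) :
    |(copyMeet p q : ℤ) - X.meet x.1.1 y.1.1| ≤ (level T + 2 * K + 2 * k + 1 : ℕ) := by
  obtain ⟨hx1, hx2, hx3⟩ := hx
  obtain ⟨hy1, hy2, hy3⟩ := hy
  have h1 : copyMeet p q ≤ X.meet x.1.1 y.1.1 + (level T + 2 * K + 2 * k + 1) := by
    unfold copyMeet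
    split_ifs with hpq
    · obtain ⟨l1, l2, l3⟩ := le_lcp_iff.1 (le_refl (lcp p.2 q.2))
      -- A vertex may be `K` letters shorter than its word suggests, so the comparison stops `K`
      -- letters early.
      by_cases hsmall : lcp p.2 q.2 ≤ K
      · omega
      have hj1 := Nat.div_mul_le_self (lcp p.2 q.2 - K) k
      have hj2 := Nat.lt_div_mul_add (a := lcp p.2 q.2 - K) (b := k) hk
      set j := (lcp p.2 q.2 - K) / k
      have e : p.2.take (j * k) = q.2.take (j * k) :=
        (le_lcp_iff.1 (show j * k ≤ lcp p.2 q.2 by omega)).2.2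
      have hm : level T + 1 + j * k ≤ X.meet x.1.1 y.1.1 := by
        refine le_meet_iff.2 ⟨by omega, by omega, ?_⟩
        rw [hx3 j (by omega) (by omega), hy3 j (by omega) (by omega), run_congr hpq e]
      omega
    · omega
  have h2 : X.meet x.1.1 y.1.1 ≤ copyMeet p q + (level T + 2 * K + 2 * k + 1) := by
    by_cases hsmall : X.meet x.1.1 y.1.1 ≤ level T + 1 + K + k
    · omega
    obtain ⟨l1, l2, l3⟩ := le_meet_iff.1 (le_refl (X.meet x.1.1 y.1.1))
    have hj1 := Nat.div_mul_le_self (X.meet x.1.1 y.1.1 - (level T + 1 + K)) k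
    have hj2 := Nat.lt_div_mul_add (a := X.meet x.1.1 y.1.1 - (level T + 1 + K)) (b := k) hk
    set j := (X.meet x.1.1 y.1.1 - (level T + 1 + K)) / k
    have hj0 : j ≠ 0 := by
      intro h0; rw [h0] at hj2; omega
    -- Of the `i + 1` blocks covered by the common component only the first `i` are known to agree.
    obtain ⟨i, hi⟩ := Nat.exists_eq_add_one_of_ne_zero hj0
    rw [hi] at hj1 hj2
    have e : (run start step k (i + 1) p).1 = (run start step k (i + 1) q).1 := by
      rw [← hx3 (i + 1) (by omega) (by omega), ← hy3 (i + 1) (by omega) (by omega)]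
      exact (le_meet_iff.1 (show level T + 1 + (i + 1) * k ≤ X.meet x.1.1 y.1.1 by omega)).2.2
    obtain ⟨e1, e2⟩ := run_fst_inj hstep hstart (by omega) (by omega) e
    rw [Nat.succ_mul] at hj1 hj2
    have hl : i * k ≤ lcp p.2 q.2 := le_lcp_iff.2 ⟨by omega, by omega, e2⟩
    rw [copyMeet, if_pos e1]
    omega
  rw [abs_le]
  constructor <;> omega

/-- Read up to unit 0 of the ancestor component at the last block level, then append the remaining
letters of `x` and the code of the ancestor, which separates the vertices of that component. -/
theorem exists_injective_to_words (hk : 1 ≤ k) (hstep : IsStep T k step)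
    (hstart : Set.BijOn start Set.univ (units T (children 1 T)))
    {code : List (Fin N) → List (Fin N)} (hcode : ∀ x, (code x).length = K)
    (hinj : ∀ x y, X.comp x = X.comp y → code x = code y → x = y) :
    ∃ f : ((tops T)ᶜ : Set (descendants T)) → Fin n₀ × List (Fin N), Function.Injective f ∧
      ∀ x, Corresponds T start step k K x (f x) := by
  let n : ((tops T)ᶜ : Set (descendants T)) → ℕ := fun x => (x.1.1.length - (level T + 1)) / k
  have hn : ∀ x : ((tops T)ᶜ : Set (descendants T)), level T + (1 + n x * k) ≤ x.1.1.length :=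
    fun x => by
      have h1 := lt_length_of_notMem_tops x
      have h2 : n x * k ≤ x.1.1.length - (level T + 1) := Nat.div_mul_le_self _ k
      omega
  have key : ∀ x : ((tops T)ᶜ : Set (descendants T)), ∃ p : Fin n₀ × List (Fin N),
      p.2.length = n x * k ∧
      run start step k (n x) p = (X.comp (x.1.1.take (level T + (1 + n x * k))), 0) := fun x => by
    have h1 := comp_take_mem_children x.1.2 (hn x)
    exact exists_run_eq hstep hstart h1 (isBelow_of_mem_children (by omega) h1).weight_pos
  choose p hp1 hp2 using key
  let f : ((tops T)ᶜ : Set (descendants T)) → Fin n₀ × List (Fin N) := fun x =>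
    ((p x).1, (p x).2 ++ (x.1.1.drop (level T + (1 + n x * k)) ++
      code (x.1.1.take (level T + (1 + n x * k)))))
  have hlen : ∀ x, (f x).2.length + (level T + 1) = x.1.1.length + K := fun x => by
    have := hn x
    simp only [f, List.length_append, List.length_drop, hp1, hcode]
    omega
  refine ⟨f, fun x y hxy => ?_, fun x => ⟨?_, ?_, fun j hj hj' => ?_⟩⟩
  · have hl : x.1.1.length = y.1.1.length := by
      have h1 := hlen x; have h2 := hlen y; rw [hxy] at h1; omega
    have hnn : n x = n y := by simp only [n, hl]
    have h1 := congrArg Prod.fst hxy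
    have h2 := congrArg Prod.snd hxy
    simp only [f] at h1 h2
    obtain ⟨h3, h4⟩ := List.append_inj h2 (by rw [hp1, hp1, hnn])
    obtain ⟨h5, h6⟩ := List.append_inj h4 (by simp [hl, hnn])
    have h7 := hp2 x
    rw [Prod.ext h1 h3, hnn, hp2 y] at h7
    rw [hnn] at h5 h6
    have h8 := hinj _ _ (congrArg Prod.fst h7).symm h6
    refine Subtype.ext (Subtype.ext ?_)
    rw [← List.take_append_drop (level T + (1 + n y * k)) x.1.1, h8, h5, List.take_append_drop]
  · have := hlen x; omega
  · have := hlen x; omega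
  · have hjn : j ≤ n x := (Nat.le_div_iff_mul_le hk).2 (by omega)
    have hjk := Nat.mul_le_mul_right k hjn
    have h1 : run start step k j (f x) = run start step k j (p x) :=
      run_congr (p := f x) (p' := p x) rfl
        (List.take_append_of_le_length ((hp1 x).symm ▸ hjk))
    rw [h1, ← trunc_run hstep hstart hjn (hp1 x).ge, hp2, trunc_comp, List.take_take,
      min_eq_left (by omega)]

/-- A component has at least as many vertices as units, so the unit reached after the last full
block selects a vertex, and the leftover letters are appended to it. Levels match exactly. -/
theorem exists_injective_from_words (hk : 1 ≤ k) (hstep : IsStep T k step)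
    (hstart : Set.BijOn start Set.univ (units T (children 1 T))) :
    ∃ g : Fin n₀ × List (Fin N) → ((tops T)ᶜ : Set (descendants T)), Function.Injective g ∧
      ∀ p, (g p).1.1.length = level T + 1 + p.2.length ∧
        Corresponds T start step k K (g p) p := by
  have key : ∀ S : X.Component, ∃ e : ℕ → List (Fin N), Set.BijOn e (Set.Iio (size S)) S.supp :=
    fun S => exists_bijOn_of_ncard_eq (Set.finite_Iio _) (finite_supp S) (by
      rw [← Finset.coe_Iio, Set.ncard_coe_finset, Nat.card_Iio]; rfl)
  choose e he using key
  let n : Fin n₀ × List (Fin N) → ℕ := fun p => p.2.length / k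
  have hn : ∀ p, n p * k ≤ p.2.length := fun p => Nat.div_mul_le_self _ k
  let r : Fin n₀ × List (Fin N) → X.Component × ℕ := fun p => run start step k (n p) p
  have hr2 : ∀ p, (r p).2 < size (r p).1 := fun p =>
    (run_mem hstep hstart (hn p)).2.trans_le (weight_le_size _ _)
  have hcomp : ∀ p, X.comp (e (r p).1 (r p).2) = (r p).1 := fun p => (he _).mapsTo (hr2 p)
  have hlen : ∀ p, (e (r p).1 (r p).2).length = level T + 1 + n p * k := fun p => by
    rw [← level_run hstep hstart (hn p), ← level_comp (X := X), hcomp]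
  have hmem : ∀ p, e (r p).1 (r p).2 ++ p.2.drop (n p * k) ∈ descendants T := fun p =>
    append_mem_descendants (mem_descendants_of_comp_isBelow
      ((hcomp p).symm ▸ run_isBelow hstep hstart (hn p))) _
  have hlen' : ∀ p, (e (r p).1 (r p).2 ++ p.2.drop (n p * k)).length =
      level T + 1 + p.2.length := fun p => by
    have := hn p
    rw [List.length_append, List.length_drop, hlen]
    omega
  refine ⟨fun p => ⟨⟨_, hmem p⟩, notMem_tops (by rw [hlen']; omega)⟩, fun p q hpq => ?_,
    fun p => ⟨hlen' p, by simp only [hlen']; omega, by simp only [hlen']; omega,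
      fun j hj hj' => ?_⟩⟩
  · have h : e (r p).1 (r p).2 ++ p.2.drop (n p * k) = e (r q).1 (r q).2 ++ q.2.drop (n q * k) :=
      congrArg (fun z : ((tops T)ᶜ : Set (descendants T)) => z.1.1) hpq
    have hl : p.2.length = q.2.length := by
      have := congrArg List.length h
      rw [hlen', hlen'] at this
      omega
    have hnn : n p = n q := by simp only [n, hl]
    obtain ⟨h1, h2⟩ := List.append_inj h (by rw [hlen, hlen, hnn])
    have h3 : (r p).1 = (r q).1 := by rw [← hcomp p, h1, hcomp q]
    have h4 : (r p).2 = (r q).2 := by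
      have h5 := hr2 q
      rw [h3] at h1
      rw [← h3] at h5
      exact (he _).injOn (h3 ▸ hr2 p) (hr2 q) h1
    have h5 : run start step k (n q) p = run start step k (n q) q := by
      have := Prod.ext h3 h4
      simp only [r, hnn] at this
      exact this
    obtain ⟨h6, h7⟩ := run_inj hstep hstart (hnn ▸ hn p) (hn q) h5
    refine Prod.ext h6 ?_
    rw [hnn] at h2
    rw [← List.take_append_drop (n q * k) p.2, h7, h2, List.take_append_drop]
  · have hjn : j ≤ n p := (Nat.le_div_iff_mul_le hk).2 hj'
    have hjk := Nat.mul_le_mul_right k hjn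
    simp only
    rw [List.take_append_of_le_length (by rw [hlen]; omega), ← trunc_comp, hcomp]
    exact trunc_run hstep hstart hjn (hn p)

end Correspondence

/-- Below `T`, the tree of components is roughly equivalent to finitely many copies of the tree of
words. -/
theorem exists_roughEquiv_copies (hN : 1 ≤ N) (hA : (incidenceMatrix T).IsPrimitive) :
    ∃ n₀, 1 ≤ n₀ ∧ (2 ≤ N ∨ n₀ = 1) ∧
      RoughEquiv (fun x y : ((tops T)ᶜ : Set (descendants T)) => X.meet x.1.1 y.1.1)
        (copyMeet (ι := Fin n₀) (α := Fin N)) := by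
  have : Nonempty X.Component := ⟨T⟩
  obtain ⟨k, hk, step, hstep⟩ := exists_isStep hN hA
  obtain ⟨K, code, hcode, hinj⟩ := exists_code hN X
  -- The machine starts one level below `T`: the gcd is taken over components other than `T`, and
  -- need not divide the size of `T`.
  obtain ⟨start, hstart⟩ := exists_bijOn_of_ncard_eq
    (s := (Set.univ : Set (Fin (∑ R ∈ children 1 T, weight T R))))
    Set.finite_univ (finite_units (T := T) (children 1 T))
    (by rw [ncard_units, Set.ncard_univ, Nat.card_fin])
  obtain ⟨f, hf, hfR⟩ := exists_injective_to_words hk hstep hstart hcode hinj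
  obtain ⟨g, hg, hgR⟩ := exists_injective_from_words (K := K) hk hstep hstart
  -- Each pair matched by the Schröder–Bernstein bijection comes from `f` or from `g`, so it still
  -- satisfies `Corresponds`.
  obtain ⟨h, hbij, hR⟩ := Function.Embedding.schroeder_bernstein_of_rel hf hg
    (Corresponds T start step k K) hfR fun p => (hgR p).2
  refine ⟨_, ?_, ?_, Equiv.ofBijective h hbij, level T + 2 * K + 2 * k + 1,
    fun x y => (hR x).abs_sub_le hk hstep hstart (hR y)⟩
  · obtain ⟨x, hx⟩ := T.nonempty_supp
    have hR1 : X.comp (x ++ [⟨0, hN⟩]) ∈ children 1 T :=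
      offspring_subset_children ⟨x, hx, ⟨0, hN⟩, rfl⟩
    exact (isBelow_of_mem_children le_rfl hR1).weight_pos.trans_le
      (Finset.single_le_sum (f := fun R => weight T R) (fun _ _ => Nat.zero_le _) hR1)
  · obtain rfl | hN2 := hN.eq_or_lt
    · right
      apply le_antisymm
      -- For one letter a word is determined by its length, so injectivity of `g` on the empty words
      -- of the copies leaves room for only one copy.
      · have hsub : ∀ i j : Fin (∑ R ∈ children 1 T, weight T R), i = j := fun i j => by
          have : g (i, []) = g (j, []) := Subtype.ext (Subtype.ext
            (words_ext_of_subsingleton (by rw [(hgR _).1, (hgR _).1])))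
          exact congrArg Prod.fst (hg this)
        by_contra hlt
        have := hsub ⟨0, by omega⟩ ⟨1, by omega⟩
        simp at this
      · obtain ⟨x, hx⟩ := T.nonempty_supp
        have hR1 : X.comp (x ++ [0]) ∈ children 1 T :=
          offspring_subset_children ⟨x, hx, 0, rfl⟩
        exact (isBelow_of_mem_children le_rfl hR1).weight_pos.trans_le
          (Finset.single_le_sum (f := fun R => weight T R) (fun _ _ => Nat.zero_le _) hR1)
    · exact Or.inl hN2

end AugmentedTree

/-! ### From rough equivalences to the proposition -/

namespace HasMeet

variable {V W : Type*} {G : SimpleGraph V} {H : SimpleGraph W} {m : V → V → ℕ} {m' : W → W → ℕ}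
  {M M' : ℕ}

theorem nearIsometric (h : HasMeet G m M) (h' : HasMeet H m' M') {E : Set V} {F : Set W}
    (hE : E.Finite) (hF : F.Finite) (σ : (Eᶜ : Set V) ≃ (Fᶜ : Set W)) (c : ℕ)
    (hσ : ∀ x y, |(m' (σ x) (σ y) : ℤ) - m x y| ≤ c) : NearIsometric G H := by
  -- The two levels contribute `c` each and the doubled product `2 * c`; the final 1 makes the
  -- inequality strict.
  refine ⟨E, F, (4 * c + M + M' + 1 : ℕ), σ, hE, hF, by positivity, fun x y => ?_⟩
  have h1 := abs_le.1 (hσ x x)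
  have h2 := abs_le.1 (hσ y y)
  have h3 := abs_le.1 (hσ x y)
  have a1 := h.le_dist x y
  have a2 := h.dist_le x y
  have b1 := h'.le_dist (σ x) (σ y)
  have b2 := h'.dist_le (σ x) (σ y)
  have key : |(H.dist (σ x : W) (σ y) : ℤ) - G.dist (x : V) y| < (4 * c + M + M' + 1 : ℕ) := by
    rw [abs_lt]
    push_cast
    constructor <;> linarith [h1.1, h1.2, h2.1, h2.2, h3.1, h3.2]
  exact_mod_cast key

theorem lipschitzEquivalent (h : HasMeet G m M) (h' : HasMeet H m' M') {E : Set V} {F : Set W}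
    (hE : E.Finite) (hF : F.Finite) (σ : (Eᶜ : Set V) ≃ (Fᶜ : Set W)) (c : ℕ)
    (hσ : ∀ x y, |(m' (σ x) (σ y) : ℤ) - m x y| ≤ c) (o : V) (o' : W) {a : ℝ} (ha : 0 < a) :
    LipschitzEquivalent (boundaryRho G o a) (boundaryRho H o' a) := by
  refine lipschitzEquivalent_boundaryRho h.connected h'.connected o o' hE hF σ
    ((m' o' o' + 2 * M') + c + (m o o + 2 * M)) (fun x y => ?_) ha
  have h1 := abs_le.1 (h.abs_gromovProduct_sub_le o x y)
  have h2 := abs_le.1 (h'.abs_gromovProduct_sub_le o' (σ x) (σ y))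
  have h3 : |(m' (σ x) (σ y) : ℝ) - m x y| ≤ c := by exact_mod_cast hσ x y
  rw [abs_le] at h3 ⊢
  constructor <;> linarith [h1.1, h1.2, h2.1, h2.2, h3.1, h3.2]

end HasMeet

theorem AugmentedTree.finite_tops {N : ℕ} {X : AugmentedTree N} (T : X.Component) :
    (AugmentedTree.tops T).Finite :=
  (finite_supp T).preimage Subtype.val_injective.injOn

theorem proposition4p2 (N : ℕ) (hN : 1 ≤ N) (X : AugmentedTree N) [X.IsSimple]
    (T : X.Component) (hA : (AugmentedTree.incidenceMatrix T).IsPrimitive) :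
    (∀ t : AugmentedTree.descendants T,
      IsHyperbolicGraph (AugmentedTree.descendantGraph T) t ∧
      ∀ a : ℝ, 0 < a →
        LipschitzEquivalent
          (boundaryRho (AugmentedTree.descendantGraph T) t a)
          (boundaryRho (naryTree N) [] a)) ∧
    NearIsometric (AugmentedTree.descendantGraph T)
      (copiesUnion (naryTree N) [] T.supp.ncard) := by
  obtain ⟨M, hM⟩ := AugmentedTree.exists_ncard_supp_le X
  have hT := AugmentedTree.hasMeet_descendantGraph T hM
  obtain ⟨n₀, hn₀, hN₀, hrough⟩ := AugmentedTree.exists_roughEquiv_copies hN hA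
  have hword := hrough.trans (roughEquiv_copies hn₀ hN₀)
  refine ⟨fun t => ⟨hT.isHyperbolicGraph (fun x y z => AugmentedTree.min_meet_le _ _ _) t,
    fun a ha => ?_⟩, ?_⟩
  · obtain ⟨e, c, he⟩ := hword
    -- The finite set `T` is removed on one side and nothing on the other.
    exact hT.lipschitzEquivalent (hasMeet_naryTree N) (AugmentedTree.finite_tops T)
      (F := ∅) Set.finite_empty (e.trans (Equiv.subtypeUnivEquiv (by simp)).symm) c he t [] ha
  · have hℓ : 1 ≤ T.supp.ncard := AugmentedTree.size_pos T
    have hNℓ : 2 ≤ N ∨ T.supp.ncard = 1 := by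
      obtain rfl | hN2 := hN.eq_or_lt
      · refine Or.inr (le_antisymm ?_ hℓ)
        rw [Set.ncard_le_one_iff (AugmentedTree.finite_supp T)]
        intro x y hx hy
        exact AugmentedTree.words_ext_of_subsingleton
          (AugmentedTree.length_eq_of_comp_eq (hx.trans hy.symm))
      · exact Or.inl hN2
    -- Passing through a single copy replaces the number of copies found below `T` by the number of
    -- words of `T`.
    obtain ⟨e, c, he⟩ := hword.trans (roughEquiv_copies hℓ hNℓ).symm
    let some' : Fin T.supp.ncard × List (Fin N) ≃
        (({none} : Set (Option (Fin T.supp.ncard × List (Fin N))))ᶜ : Set _) :=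
      Equiv.ofBijective (fun p => ⟨some p, by simp⟩) ⟨fun p q h => by simpa using h, by
        rintro ⟨_ | p, hp⟩
        · simp at hp
        · exact ⟨p, rfl⟩⟩
    exact hT.nearIsometric (hasMeet_copiesUnion N _) (AugmentedTree.finite_tops T)
      (Set.finite_singleton none) (e.trans some') c he
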